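/- Let $q$ be a prime power, $m\ge 1$, $Q=q^m$, and let $\gamma$ be a primitive element of $\mathbb F_Q$. For an integer $b$ let $h_b(x)$ be the minimal polynomial of $\gamma^{-b}$ over $\mathbb F_q$. Let $t\ge 1$ and put $e=t$. Let $a,a_1,\dots,a_t,\Delta_1,\dots,\Delta_t$ be integers such that 1. $e\mid Q-1$ and $a\not\equiv 0 \pmod{Q-1}$; 2. $a_i\equiv a+\frac{Q-1}{e}\Delta_i \pmod{Q-1}$ for $1\le i\le t$, where $\Delta_i\not\equiv\Delta_j\pmod e$ for $i\ne j$ and $\gcd(\Delta_2-\Delta_1,\dots,\Delta_t-\Delta_1,e)=1$; 3. $\deg h_{a_i}=m$ for $1\le i\le t$, and $h_{a_i}\ne h_{a_j}$ for $i\neq j$. Put $$\delta=\gcd(Q-1,a_1,\dots,a_t),\qquad n=\frac{Q-1}{\delta},\qquad N=\gcd\Bigl(\frac{Q-1}{q-1},\,ae\Bigr),$$ and let $\mathcal C$ be the cyclic code of length $n$ over $\mathbb F_q$ with parity check polynomial $h(x)=\prod_{i=1}^t h_{a_i}(x)$, that is, the set of $(c_0,\dots,c_{n-1})\in\mathbb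 F_q^n$ such that $\sum_i c_ix^i$ lies in the ideal of $\mathbb F_q[x]/(x^n-1)$ generated by $(x^n-1)/h(x)$. For a subcode $\mathcal D\subseteq\mathcal C$ let $\mathrm{supp}(\mathcal D)$ be the set of coordinates at which some word of $\mathcal D$ is nonzero, and let $$d_r=\min\{|\mathrm{supp}(\mathcal D)| : \mathcal D\subseteq\mathcal C \text{ a linear subcode},\ \dim_{\mathbb F_q}\mathcal D=r\}$$ be the $r$-th generalized Hamming weight of $\mathcal C$. Then $\dim_{\mathbb F_q}\mathcal C=tm$, and for every integer $s$ with $0\le s\le t-1$ and every integer $r$ the following hold. (i) If $N=1$, then $$d_r=\frac{q^m-1}{\delta}\Bigl(1-\frac st\Bigr)-\frac{q^{(t-s)m-r}-1}{t\delta}\qquad\text{if } (t-s-1)m<r\le (t-s)m.$$ (ii) If $N=2$, then $$d_r=\begin{cases}\dfrac{q^m-1}{\delta}\Bigl(1-\dfrac st\Bigr)-\dfrac{1}{t\delta}\bigl(q^{(t-s-\frac12)m-r}+1\bigr)\bigl(q^{m/2}-1\bigr) & \text{if } (t-s-1)m<r\le (t-s-\tfrac12)m,\\[2mm] \dfrac{q^m-1}{\delta}\Bigl(1-\dfrac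 st\Bigr)-\dfrac{2}{t\delta}\bigl(q^{(t-s)m-r}-1\bigr) & \text{if } (t-s-\tfrac12)m<r\le (t-s)m.\end{cases}$$ -/

import Mathlib

open Polynomial

noncomputable section

/-- The support of a linear code `D ⊆ F^n`: the coordinates at which some word of `D` is nonzero. -/
def codeSupport {F : Type*} [Field F] {n : ℕ} (D : Submodule F (Fin n → F)) : Set (Fin n) :=
  {i | ∃ c ∈ D, c i ≠ 0}

/-- The `r`-th generalized Hamming weight of `C`: the least support size of an `r`-dimensional
subcode (meaningful for `r ≤ dim C`). -/
def genHammingWeight {F : Type*} [Field F] {n : ℕ} (C : Submodule F (Fin n → F)) (r : ℕ) : ℕ :=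
  sInf {w | ∃ D : Submodule F (Fin n → F), D ≤ C ∧ Module.finrank F D = r ∧
    w = (codeSupport D).ncard}

/-- The word `(c_0, …, c_{n-1})` read as the class of `∑ c_i x^i` in `F[x] / (x^n - 1)`. -/
def wordClass (F : Type*) [Field F] (n : ℕ) :
    (Fin n → F) →ₗ[F] (F[X] ⧸ Ideal.span {(X : F[X]) ^ n - 1}) :=
  (Ideal.Quotient.mkₐ F (Ideal.span {(X : F[X]) ^ n - 1})).toLinearMap ∘ₗ
    ∑ i : Fin n, (Polynomial.monomial (i : ℕ)) ∘ₗ LinearMap.proj i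

/-- The cyclic code of length `n` over `F` with parity check polynomial `h` (a divisor of
`x^n - 1`): the words whose class lies in the ideal of `F[x] / (x^n - 1)` generated by the
generator polynomial `(x^n - 1) / h`. -/
def cyclicCode (F : Type*) [Field F] (n : ℕ) (h : F[X]) : Submodule F (Fin n → F) :=
  Submodule.comap (wordClass F n)
    (Submodule.restrictScalars F
      (Ideal.span {Ideal.Quotient.mk (Ideal.span {(X : F[X]) ^ n - 1}) ((X ^ n - 1) / h)}))

/-- The polynomial `h_b`: the minimal polynomial of `γ^{-b}` over `F`. -/
def hPoly (F : Type*) {L : Type*} [Field F] [Field L] [Algebra F L] (γ : Lˣ) (b : ℤ) : F[X] :=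
  minpoly F ((γ ^ (-b) : Lˣ) : L)

end

noncomputable section

/-! By Delsarte, the code consists of the words `(Tr ∑ x_i α_i ^ j)_j` with `x ∈ L ^ t` and `α_i = γ
^ a_i` (`cyclicCode_eq_range_traceCode`). Here `α_i = γ ^ a * v_i` with `v_i` distinct `t`-th roots
of unity, so for `j = k + t l` the inner sum is `z_k(x) * γ ^ (a t l)`, where `z_k(x) = γ ^ (a k) *
∑ x_i v_i ^ k`. The Vandermonde determinant makes `x ↦ (z_k(x))_k` invertible: the positions fall
into `t` classes, each governed by its own free element of `L` (`mul_ncard_codeSupport`).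

The support of a subcode is thus, up to the factor `t δ`, a sum over `k` of weights of the images
`U_k` under `z_k`. Modulo `Fˣ` the values `x ^ (a t)` are equidistributed over `⟨γ ^ N⟩`, so the
weight of `U` is `Q - 1 - N |Uᗮ ∩ ⟨γ ^ N⟩|` (`unitWeight_add`). Let `B u` be the maximum of `N |U ∩
⟨γ ^ N⟩|` over `u`-dimensional `U`. For an `r`-dimensional subcode the codimensions of the `U_k` add
up to at most `t m - r = s m + u`. Since `B` is convex, the weight is least when `s` of the `U_k`
are zero, one has codimension `u` and the others are `L` (`sum_le_of_increments_monotone`). Hence `t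
δ d_r = (t - s)(Q - 1) - B u` (`genHammingWeight_range_traceCode`).

For `N = 1`, `B u = q ^ u - 1`. For `N = 2`, `q` is odd, `m = 2h`, and `B u` is twice the largest
number of nonzero squares in a `u`-dimensional subspace. If `u ≤ h`, subspaces of the subfield of
order `q ^ h` consist of squares. If `u > h`, Poisson summation with Gauss sum `± q ^ h` reduces the
count to the orthogonal complement (`exists_sign_quadraticCharSum`). -/

/-! ### Sums over residue classes and convex sequences -/

theorem sum_range_mul_eq_sum_sum (f : ℕ → ℕ) (a b : ℕ) :
    ∑ j ∈ Finset.range (a * b), f j =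
      ∑ k ∈ Finset.range a, ∑ l ∈ Finset.range b, f (k + a * l) := by
  rw [Finset.sum_comm]
  induction b with
  | zero => simp
  | succ b ih =>
    rw [Finset.sum_range_succ, Nat.mul_succ, Finset.sum_range_add, ih]
    congr 1
    exact Finset.sum_congr rfl fun k _ => by rw [add_comm]

theorem sum_range_mul_of_periodic {f : ℕ → ℕ} {a : ℕ} (hf : ∀ j, f (j + a) = f j) (b : ℕ) :
    ∑ j ∈ Finset.range (a * b), f j = b * ∑ k ∈ Finset.range a, f k := by
  have h : ∀ l k, f (k + a * l) = f k := by
    intro l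
    induction l with
    | zero => simp
    | succ l ih => intro k; rw [Nat.mul_succ, ← add_assoc, hf, ih]
  rw [sum_range_mul_eq_sum_sum, Finset.mul_sum]
  simp [h]

/-- Moving the arguments of a convex function apart increases the sum of its values. -/
theorem add_le_add_of_increments_monotone {B : ℕ → ℝ} {m : ℕ}
    (hB : ∀ i, i + 2 ≤ m → B (i + 1) - B i ≤ B (i + 2) - B (i + 1)) (d : ℕ) :
    ∀ i j, j ≤ i → d ≤ j → i + d ≤ m → B i + B j ≤ B (i + d) + B (j - d) := by
  have hmono : ∀ k i, i + k + 1 ≤ m → B (i + 1) - B i ≤ B (i + k + 1) - B (i + k) := by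
    intro k
    induction k with
    | zero => intro i _; simp
    | succ k ih =>
      intro i hi
      have h1 := ih i (by omega)
      have h2 := hB (i + k) (by omega)
      rw [show i + (k + 1) + 1 = i + k + 2 by omega, show i + (k + 1) = i + k + 1 by omega]
      linarith
  induction d with
  | zero => intro i j _ _ _; simp
  | succ d ih =>
    intro i j hij hd hi
    have h1 := ih i j hij (by omega) (by omega)
    have h2 := hmono (i + d - (j - (d + 1))) (j - (d + 1)) (by omega)
    rw [show j - (d + 1) + (i + d - (j - (d + 1))) = i + d by omega,
      show j - (d + 1) + 1 = j - d by omega] at h2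
    rw [← add_assoc]
    linarith

/-- The two arguments are spread until one hits an end of `[0, m]`: the smaller reaches `0` or the
larger reaches `m`. -/
theorem add_le_of_increments_monotone {B : ℕ → ℝ} {m : ℕ} (h0 : B 0 = 0)
    (hB : ∀ i, i + 2 ≤ m → B (i + 1) - B i ≤ B (i + 2) - B (i + 1)) {i j : ℕ}
    (hi : i ≤ m) (hj : j ≤ m) :
    (i + j ≤ m → B i + B j ≤ B (i + j)) ∧ (m ≤ i + j → B i + B j ≤ B m + B (i + j - m)) := by
  wlog hij : j ≤ i generalizing i j
  · have := this hj hi (by omega)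
    rwa [add_comm i j, add_comm (B i)]
  constructor
  · intro h
    have := add_le_add_of_increments_monotone hB j i j hij le_rfl h
    simpa [h0] using this
  · intro h
    have := add_le_add_of_increments_monotone hB (m - i) i j hij (by omega) (by omega)
    rwa [show i + (m - i) = m by omega, show j - (m - i) = i + j - m by omega] at this

/-- A sum of values of a convex function on `[0, m]` vanishing at `0` is greatest when all but one
of the arguments are extreme. -/
theorem sum_le_of_increments_monotone {B : ℕ → ℝ} {m : ℕ} (hm : 0 < m) (h0 : B 0 = 0)
    (hB1 : 0 ≤ B 1)
    (hB : ∀ i, i + 2 ≤ m → B (i + 1) - B i ≤ B (i + 2) - B (i + 1))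
    {ι : Type*} (S : Finset ι) (w : ι → ℕ) (hw : ∀ k ∈ S, w k ≤ m) {s u : ℕ} (hu : u < m)
    (hsum : ∑ k ∈ S, w k ≤ s * m + u) :
    ∑ k ∈ S, B (w k) ≤ s * B m + B u := by
  -- `G x` is the candidate maximum for total `x`: as many arguments equal to `m` as possible, and
  -- the remainder in one more.
  set G : ℕ → ℝ := fun x => (x / m : ℕ) * B m + B (x % m) with hG
  have hGadd : ∀ x w, w ≤ m → B w + G x ≤ G (x + w) := by
    intro x w hw
    have hc : x % m < m := Nat.mod_lt _ hm
    have hx : x = x / m * m + x % m := (Nat.div_add_mod' x m).symm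
    obtain ⟨h1, h2⟩ := add_le_of_increments_monotone h0 hB hw hc.le
    rcases lt_or_ge (w + x % m) m with h | h
    · have e1 : (x + w) / m = x / m := by
        rw [Nat.div_eq_iff hm]
        generalize x / m * m = p at hx ⊢
        omega
      have e2 : (x + w) % m = w + x % m := by
        have := Nat.div_add_mod' (x + w) m
        rw [e1] at this; omega
      simp only [hG, e1, e2]
      linarith [h1 h.le]
    · rcases lt_or_ge (w + x % m - m) m with h' | h'
      · have e1 : (x + w) / m = x / m + 1 := by
          rw [Nat.div_eq_iff hm, add_mul]
          generalize x / m * m = p at hx ⊢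
          omega
        have e2 : (x + w) % m = w + x % m - m := by
          have := Nat.div_add_mod' (x + w) m
          rw [e1, add_mul] at this; omega
        simp only [hG, e1, e2]
        push_cast
        linarith [h2 h]
      · omega
  have hGmono : Monotone G := monotone_nat_of_le_succ fun x => by
    linarith [hGadd x 1 hm]
  have hle : ∑ k ∈ S, B (w k) ≤ G (∑ k ∈ S, w k) := by
    classical
    induction S using Finset.induction_on with
    | empty => simp [hG, h0]
    | insert i S hi ih =>
      rw [Finset.sum_insert hi, Finset.sum_insert hi]
      have h1 := ih (fun k hk => hw k (Finset.mem_insert_of_mem hk))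
        (by rw [Finset.sum_insert hi] at hsum; omega)
      have h2 := hGadd (∑ k ∈ S, w k) (w i) (hw i (Finset.mem_insert_self _ _))
      rw [add_comm (w i)]
      linarith
  have hval : G (s * m + u) = s * B m + B u := by
    have e1 : (s * m + u) / m = s := by
      rw [add_comm, Nat.add_mul_div_right _ _ hm, Nat.div_eq_of_lt hu, zero_add]
    have e2 : (s * m + u) % m = u := by
      rw [add_comm, Nat.add_mul_mod_self_right, Nat.mod_eq_of_lt hu]
    simp only [hG, e1, e2]
  rw [← hval]
  exact hle.trans (hGmono hsum)

/-! ### Cyclic codes as trace codes -/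

variable {F L : Type*} [Field F] [Field L] [Algebra F L]

/-- The word `(Tr (y α^j))_j` of the irreducible cyclic code attached to `α`. -/
def traceWord (F : Type*) {L : Type*} [Field F] [Field L] [Algebra F L] (n : ℕ) (α : Lˣ) :
    L →ₗ[F] (Fin n → F) :=
  LinearMap.pi fun j : Fin n =>
    Algebra.trace F L ∘ₗ LinearMap.mulRight F ((α : L) ^ (j : ℕ))

@[simp] theorem traceWord_apply (n : ℕ) (α : Lˣ) (y : L) (j : Fin n) :
    traceWord F n α y j = Algebra.trace F L (y * (α : L) ^ (j : ℕ)) := rfl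

theorem wordClass_apply (n : ℕ) (c : Fin n → F) :
    wordClass F n c = Ideal.Quotient.mk (Ideal.span {(X : F[X]) ^ n - 1})
      (∑ i : Fin n, monomial (i : ℕ) (c i)) := by
  simp [wordClass]

theorem wordClass_injective {n : ℕ} (hn : 0 < n) : Function.Injective (wordClass F n) := by
  rw [injective_iff_map_eq_zero]
  intro c hc
  rw [wordClass_apply, Ideal.Quotient.eq_zero_iff_mem, Ideal.mem_span_singleton] at hc
  have hdeg : (∑ i : Fin n, monomial (i : ℕ) (c i)).degree < ((X : F[X]) ^ n - 1).degree := by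
    rw [← C_1, degree_X_pow_sub_C hn]
    refine (degree_sum_le _ _).trans_lt ?_
    refine (Finset.sup_lt_iff (WithBot.bot_lt_coe n)).2 fun i _ => ?_
    exact (degree_monomial_le _ _).trans_lt (Nat.cast_lt.2 i.2)
  have h0 := eq_zero_of_dvd_of_degree_lt hc hdeg
  funext i
  have := congrArg (fun p => p.coeff (i : ℕ)) h0
  simpa [finsetSum_coeff, coeff_monomial, Fin.val_inj] using this

/-- Multiplication by `X` is a cyclic shift of the word, which replaces `α ^ j` by `α ^ (j - 1)`. -/
theorem X_mul_wordClass_traceWord {n : ℕ} {α : Lˣ} (hα : α ^ n = 1) (y : L) :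
    Ideal.Quotient.mk (Ideal.span {(X : F[X]) ^ n - 1}) X * wordClass F n (traceWord F n α y) =
      wordClass F n (traceWord F n α (((α⁻¹ : Lˣ) : L) * y)) := by
  set φ := Ideal.Quotient.mk (Ideal.span {(X : F[X]) ^ n - 1})
  have hX : φ X ^ n = 1 := by
    rw [← map_pow, ← sub_eq_zero, ← map_one φ, ← map_sub, Ideal.Quotient.eq_zero_iff_mem]
    exact Ideal.mem_span_singleton_self _
  have hw : ∀ z, wordClass F n (traceWord F n α z) =
      ∑ j ∈ Finset.range n, φ (C (Algebra.trace F L (z * (α : L) ^ j))) * φ X ^ j := by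
    intro z
    rw [wordClass_apply, map_sum, Finset.sum_range]
    refine Finset.sum_congr rfl fun j _ => ?_
    rw [← C_mul_X_pow_eq_monomial, map_mul, map_pow, traceWord_apply]
  rw [hw, hw, Finset.mul_sum]
  set g : ℕ → _ := fun j =>
    φ (C (Algebra.trace F L (((α⁻¹ : Lˣ) : L) * y * (α : L) ^ j))) * φ X ^ j with hg
  -- The wrap-around of the shift: index `n` agrees with index `0` because both `X` and `α` have
  -- `n`-th power `1`.
  have hgn : g n = g 0 := by
    have : (α : L) ^ n = 1 := by
      rw [← Units.val_pow_eq_pow_val, hα, Units.val_one]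
    simp [hg, hX, this]
  have hs : ∑ j ∈ Finset.range n, g (j + 1) = ∑ j ∈ Finset.range n, g j := by
    have := (Finset.sum_range_succ' g n).symm.trans (Finset.sum_range_succ g n)
    rw [hgn] at this
    exact add_right_cancel this
  rw [← hs]
  refine Finset.sum_congr rfl fun j _ => ?_
  simp only [hg]
  rw [show ((α⁻¹ : Lˣ) : L) * y * (α : L) ^ (j + 1) = y * (α : L) ^ j by
    rw [pow_succ']
    calc _ = (((α⁻¹ : Lˣ) : L) * α) * (y * (α : L) ^ j) := by ring
      _ = _ := by rw [Units.inv_mul, one_mul]]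
  ring

theorem mk_mul_wordClass_traceWord {n : ℕ} {α : Lˣ} (hα : α ^ n = 1) (p : F[X]) (y : L) :
    Ideal.Quotient.mk (Ideal.span {(X : F[X]) ^ n - 1}) p * wordClass F n (traceWord F n α y) =
      wordClass F n (traceWord F n α (aeval ((α⁻¹ : Lˣ) : L) p * y)) := by
  induction p using Polynomial.induction_on generalizing y with
  | C c =>
    rw [aeval_C, ← Algebra.smul_def, map_smul, map_smul]
    exact (Algebra.smul_def (A := F[X] ⧸ Ideal.span {(X : F[X]) ^ n - 1}) c _).symm
  | add p r hp hr => rw [map_add, add_mul, hp, hr, map_add, add_mul, map_add, map_add]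
  | monomial k c ih =>
    rw [pow_succ, ← mul_assoc, map_mul, mul_assoc, X_mul_wordClass_traceWord hα, ih]
    simp only [map_mul, aeval_X, mul_assoc]

/-- The kernel is stable under multiplication by `α⁻¹`, which generates `L` over `F`. A nonzero
kernel is therefore all of `L`, and coordinate `0` would make the trace vanish. -/
theorem traceWord_injective_of_natDegree [FiniteDimensional F L] [Algebra.IsSeparable F L]
    {n : ℕ} (hn : 0 < n) {α : Lˣ} (hα : α ^ n = 1)
    (hdeg : (minpoly F ((α⁻¹ : Lˣ) : L)).natDegree = Module.finrank F L) :
    Function.Injective (traceWord F n α) := by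
  rw [injective_iff_map_eq_zero]
  intro y hy
  by_contra hy0
  have hzero : ∀ z : L, traceWord F n α z = 0 := by
    intro z
    have htop : (z * y⁻¹ : L) ∈ Algebra.adjoin F {((α⁻¹ : Lˣ) : L)} := by
      have hint : IsIntegral F ((α⁻¹ : Lˣ) : L) := Algebra.IsIntegral.isIntegral _
      have h1 : IntermediateField.adjoin F {((α⁻¹ : Lˣ) : L)} = ⊤ :=
        (Field.primitive_element_iff_minpoly_natDegree_eq F _).2 hdeg
      have h2 := IntermediateField.adjoin_simple_toSubalgebra_of_isAlgebraic hint.isAlgebraic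
      rw [← h2, h1]
      trivial
    rw [Algebra.adjoin_singleton_eq_range_aeval] at htop
    obtain ⟨p, hp⟩ := htop
    apply wordClass_injective (F := F) hn
    have h := mk_mul_wordClass_traceWord (F := F) hα p y
    have hp' : aeval ((α⁻¹ : Lˣ) : L) p = z * y⁻¹ := hp
    rw [hy, map_zero, mul_zero, hp', inv_mul_cancel_right₀ hy0] at h
    rw [← h, map_zero]
  obtain ⟨z, hz⟩ := DFunLike.ne_iff.1 (Algebra.trace_ne_zero F L)
  apply hz
  have := congrFun (hzero z) ⟨0, hn⟩
  simpa using this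

/-- The word `(Tr (∑ i, x i * α i ^ j))_j`. -/
def traceCode (F : Type*) {L ι : Type*} [Field F] [Field L] [Algebra F L] [Fintype ι] (n : ℕ)
    (α : ι → Lˣ) : (ι → L) →ₗ[F] (Fin n → F) :=
  ∑ i, traceWord F n (α i) ∘ₗ LinearMap.proj i

theorem traceCode_apply {ι : Type*} [Fintype ι] (n : ℕ) (α : ι → Lˣ) (x : ι → L) (j : Fin n) :
    traceCode F n α x j = Algebra.trace F L (∑ i, x i * (α i : L) ^ (j : ℕ)) := by
  simp [traceCode, map_sum]

/-- The product of the minimal polynomials other than the `i`-th kills every summand but the `i`-th,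
on which it acts as multiplication by a nonzero element. -/
theorem traceCode_injective [FiniteDimensional F L] [Algebra.IsSeparable F L]
    {ι : Type*} [Fintype ι] {n : ℕ} (hn : 0 < n) {α : ι → Lˣ} (hα : ∀ i, α i ^ n = 1)
    (hdeg : ∀ i, (minpoly F (((α i)⁻¹ : Lˣ) : L)).natDegree = Module.finrank F L)
    (hne : ∀ i j, i ≠ j → minpoly F (((α i)⁻¹ : Lˣ) : L) ≠ minpoly F (((α j)⁻¹ : Lˣ) : L)) :
    Function.Injective (traceCode F n α) := by
  classical
  rw [injective_iff_map_eq_zero]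
  intro x hx
  funext i
  set p : F[X] := ∏ j ∈ Finset.univ.erase i, minpoly F (((α j)⁻¹ : Lˣ) : L) with hp
  have hint : ∀ j, IsIntegral F (((α j)⁻¹ : Lˣ) : L) := fun j => Algebra.IsIntegral.isIntegral _
  have hpj : ∀ j, j ≠ i → aeval (((α j)⁻¹ : Lˣ) : L) p = 0 := by
    intro j hj
    rw [hp, map_prod]
    exact Finset.prod_eq_zero (Finset.mem_erase.2 ⟨hj, Finset.mem_univ _⟩) (minpoly.aeval _ _)
  have hpi : aeval (((α i)⁻¹ : Lˣ) : L) p ≠ 0 := by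
    rw [hp, map_prod, Finset.prod_ne_zero_iff]
    intro j hj h0
    exact hne j i (Finset.ne_of_mem_erase hj)
      (minpoly.eq_of_irreducible_of_monic (minpoly.irreducible (hint j)) h0
        (minpoly.monic (hint j)))
  have h : Ideal.Quotient.mk (Ideal.span {(X : F[X]) ^ n - 1}) p *
      wordClass F n (traceCode F n α x) = 0 := by rw [hx, map_zero, mul_zero]
  have hexp : wordClass F n (traceCode F n α x) =
      ∑ j, wordClass F n (traceWord F n (α j) (x j)) := by
    simp [traceCode, map_sum]
  rw [hexp, Finset.mul_sum, Finset.sum_eq_single i, mk_mul_wordClass_traceWord (hα i)] at h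
  · have h1 : traceWord F n (α i) _ = 0 :=
      wordClass_injective (F := F) hn (h.trans (map_zero _).symm)
    have h2 := (traceWord_injective_of_natDegree hn (hα i) (hdeg i)) (h1.trans (map_zero _).symm)
    exact (mul_eq_zero.1 h2).resolve_left hpi
  · intro j _ hj
    rw [mk_mul_wordClass_traceWord (hα j), hpj j hj, zero_mul, map_zero, map_zero]
  · simp

theorem mem_cyclicCode_iff {n : ℕ} {h : F[X]} (hdvd : h ∣ X ^ n - 1) (h0 : h ≠ 0)
    (c : Fin n → F) :
    c ∈ cyclicCode F n h ↔
      Ideal.Quotient.mk (Ideal.span {(X : F[X]) ^ n - 1}) h * wordClass F n c = 0 := by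
  obtain ⟨g, hg⟩ := hdvd
  have hdiv : ((X : F[X]) ^ n - 1) / h = g := by rw [hg, mul_div_cancel_left₀ _ h0]
  have hhg : Ideal.Quotient.mk (Ideal.span {(X : F[X]) ^ n - 1}) (h * g) = 0 := by
    rw [Ideal.Quotient.eq_zero_iff_mem, hg]
    exact Ideal.mem_span_singleton_self _
  simp only [cyclicCode, Submodule.mem_comap, Submodule.restrictScalars_mem, hdiv,
    Ideal.mem_span_singleton]
  constructor
  · rintro ⟨k, hk⟩
    rw [hk, ← mul_assoc, ← map_mul, hhg, zero_mul]
  · intro hc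
    rw [wordClass_apply] at hc ⊢
    rw [← map_mul, Ideal.Quotient.eq_zero_iff_mem, Ideal.mem_span_singleton] at hc
    have hc' : h * g ∣ h * ∑ i : Fin n, monomial (i : ℕ) (c i) := by rwa [← hg]
    exact map_dvd _ ((mul_dvd_mul_iff_left h0).1 hc')

theorem finrank_cyclicCode_le {n : ℕ} (hn : 0 < n) {h : F[X]} (hdvd : h ∣ X ^ n - 1)
    (hmon : h.Monic) : Module.finrank F (cyclicCode F n h) ≤ h.natDegree := by
  set I := Ideal.span {(X : F[X]) ^ n - 1} with hI
  obtain ⟨g, hg⟩ := hdvd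
  have hdiv : ((X : F[X]) ^ n - 1) / h = g := by
    rw [hg, mul_div_cancel_left₀ _ hmon.ne_zero]
  have hhg : Ideal.Quotient.mk I (h * g) = 0 := by
    rw [Ideal.Quotient.eq_zero_iff_mem, ← hg]
    exact Ideal.mem_span_singleton_self _
  let ψ : degreeLT F h.natDegree →ₗ[F] F[X] ⧸ I :=
    ((Ideal.Quotient.mkₐ F I).toLinearMap ∘ₗ LinearMap.mulLeft F g) ∘ₗ Submodule.subtype _
  have : FiniteDimensional F (degreeLT F h.natDegree) :=
    Module.Finite.equiv (degreeLTEquiv F h.natDegree).symm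
  have hle : (cyclicCode F n h).map (wordClass F n) ≤ LinearMap.range ψ := by
    rintro _ ⟨c, hc, rfl⟩
    have hc' : Ideal.Quotient.mk I g ∣ wordClass F n c := by
      have : wordClass F n c ∈ Ideal.span {Ideal.Quotient.mk I ((X ^ n - 1) / h)} := hc
      rwa [hdiv, Ideal.mem_span_singleton] at this
    obtain ⟨k, hk⟩ := hc'
    obtain ⟨k, rfl⟩ := Ideal.Quotient.mk_surjective k
    -- Since `h * g` vanishes in the quotient, a multiple `g * k` depends only on `k` modulo `h`.
    refine ⟨⟨k %ₘ h, mem_degreeLT.2 ?_⟩, ?_⟩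
    · exact (degree_modByMonic_lt k hmon).trans_le degree_le_natDegree
    · rw [hk, ← map_mul]
      change Ideal.Quotient.mk I (g * (k %ₘ h)) = _
      conv_rhs => rw [← modByMonic_add_div k h]
      rw [mul_add, map_add, show g * (h * (k /ₘ h)) = (h * g) * (k /ₘ h) by ring, map_mul _ (h * g),
        hhg, zero_mul, add_zero]
  calc Module.finrank F (cyclicCode F n h)
      = Module.finrank F ((cyclicCode F n h).map (wordClass F n)) :=
        ((Submodule.equivMapOfInjective _ (wordClass_injective hn) _).finrank_eq)
    _ ≤ Module.finrank F (LinearMap.range ψ) := Submodule.finrank_mono hle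
    _ ≤ Module.finrank F (degreeLT F h.natDegree) := LinearMap.finrank_range_le ψ
    _ = h.natDegree := by
      rw [(degreeLTEquiv F h.natDegree).finrank_eq]; simp

/-- Delsarte's description of a cyclic code by traces. -/
theorem cyclicCode_eq_range_traceCode [FiniteDimensional F L] [Algebra.IsSeparable F L]
    {ι : Type*} [Fintype ι] {n : ℕ} (hn : 0 < n) {α : ι → Lˣ} (hα : ∀ i, α i ^ n = 1)
    (hdeg : ∀ i, (minpoly F (((α i)⁻¹ : Lˣ) : L)).natDegree = Module.finrank F L)
    (hne : ∀ i j, i ≠ j → minpoly F (((α i)⁻¹ : Lˣ) : L) ≠ minpoly F (((α j)⁻¹ : Lˣ) : L)) :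
    cyclicCode F n (∏ i, minpoly F (((α i)⁻¹ : Lˣ) : L)) = LinearMap.range (traceCode F n α) := by
  classical
  have hint : ∀ j, IsIntegral F (((α j)⁻¹ : Lˣ) : L) := fun j => Algebra.IsIntegral.isIntegral _
  have hmon : (∏ i, minpoly F (((α i)⁻¹ : Lˣ) : L)).Monic :=
    monic_prod_of_monic _ _ fun i _ => minpoly.monic (hint i)
  have hdvd : (∏ i, minpoly F (((α i)⁻¹ : Lˣ) : L)) ∣ X ^ n - 1 := by
    refine Finset.prod_dvd_of_coprime ?_ fun i _ => ?_
    · intro i _ j _ hij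
      refine (Irreducible.coprime_iff_not_dvd (minpoly.irreducible (hint i))).2 fun hd => ?_
      refine hne i j hij (eq_of_monic_of_associated (minpoly.monic (hint i))
        (minpoly.monic (hint j)) ?_)
      exact (minpoly.irreducible (hint i)).associated_of_dvd (minpoly.irreducible (hint j)) hd
    · apply minpoly.dvd
      have : (((α i)⁻¹ : Lˣ) : L) ^ n = 1 := by
        rw [← Units.val_pow_eq_pow_val, inv_pow, hα, inv_one, Units.val_one]
      rw [map_sub, map_pow, aeval_X, this, map_one, sub_self]
  -- One inclusion suffices: the trace code has dimension `∑ i, [L : F]`, which is the degree of the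
  -- parity check polynomial.
  symm
  apply Submodule.eq_of_le_of_finrank_le
  · rintro _ ⟨x, rfl⟩
    rw [mem_cyclicCode_iff hdvd hmon.ne_zero]
    have hexp : wordClass F n (traceCode F n α x) =
        ∑ j, wordClass F n (traceWord F n (α j) (x j)) := by
      simp [traceCode, map_sum]
    rw [hexp, Finset.mul_sum]
    refine Finset.sum_eq_zero fun j _ => ?_
    rw [mk_mul_wordClass_traceWord (hα j), map_prod,
      Finset.prod_eq_zero (Finset.mem_univ j) (minpoly.aeval _ _), zero_mul, map_zero, map_zero]
  · rw [LinearMap.finrank_range_of_inj (traceCode_injective hn hα hdeg hne)]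
    refine (finrank_cyclicCode_le hn hdvd hmon).trans ?_
    rw [natDegree_prod_of_monic _ _ fun i _ => minpoly.monic (hint i),
      Module.finrank_pi_fintype]
    exact (Finset.sum_congr rfl fun i _ => hdeg i).le

/-! ### Orthogonality for the trace form -/

theorem exists_submodule_le_finrank_eq {K V : Type*} [Field K] [AddCommGroup V] [Module K V]
    [FiniteDimensional K V] (W : Submodule K V) {d : ℕ} (hd : d ≤ Module.finrank K W) :
    ∃ U : Submodule K V, U ≤ W ∧ Module.finrank K U = d := by
  have b := Module.finBasis K W
  have hli : LinearIndependent K fun i : Fin d => ((b (Fin.castLE hd i) : W) : V) :=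
    (b.linearIndependent.comp _ (Fin.castLE_injective hd)).map' W.subtype (Submodule.ker_subtype W)
  refine ⟨Submodule.span K (Set.range fun i : Fin d => ((b (Fin.castLE hd i) : W) : V)), ?_, ?_⟩
  · rw [Submodule.span_le]
    rintro _ ⟨i, rfl⟩
    exact (b (Fin.castLE hd i)).2
  · rw [finrank_span_eq_card hli, Fintype.card_fin]

theorem mem_orthogonal_traceForm_iff {U : Submodule F L} {x : L} :
    x ∈ (Algebra.traceForm F L).orthogonal U ↔ ∀ u ∈ U, Algebra.trace F L (u * x) = 0 := by
  rw [LinearMap.BilinForm.mem_orthogonal_iff]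
  rfl

theorem finrank_orthogonal_traceForm [Finite F] [Finite L] (U : Submodule F L) :
    Module.finrank F ((Algebra.traceForm F L).orthogonal U) =
      Module.finrank F L - Module.finrank F U :=
  LinearMap.BilinForm.finrank_orthogonal (traceForm_nondegenerate F L) U

theorem orthogonal_orthogonal_traceForm [Finite F] [Finite L] (U : Submodule F L) :
    (Algebra.traceForm F L).orthogonal ((Algebra.traceForm F L).orthogonal U) = U :=
  LinearMap.BilinForm.orthogonal_orthogonal (traceForm_nondegenerate F L)
    (Algebra.traceForm_isSymm F).isRefl U

theorem natCard_submodule [Finite F] [Finite L] (U : Submodule F L) :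
    Nat.card U = Nat.card F ^ Module.finrank F U :=
  Module.natCard_eq_pow_finrank

open scoped Classical in
-- The functional `y ↦ Tr (x y)` on `V` is either zero or onto `F`; in the latter case `ψ` composed
-- with it is a nontrivial character.
theorem sum_addChar_trace_mul [Finite F] [Fintype L] {ψ : AddChar F ℂ} (hψ : ψ ≠ 1)
    (V : Submodule F L) (x : L) :
    ∑ y : V, ψ (Algebra.trace F L (x * y)) =
      if x ∈ (Algebra.traceForm F L).orthogonal V then (Nat.card V : ℂ) else 0 := by
  let φ : AddChar V ℂ := ψ.compAddMonoidHom
    ((Algebra.trace F L ∘ₗ LinearMap.mulLeft F x) ∘ₗ V.subtype).toAddMonoidHom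
  have hφ : ∀ y : V, φ y = ψ (Algebra.trace F L (x * y)) := fun _ => rfl
  simp_rw [← hφ]
  split_ifs with h
  · rw [mem_orthogonal_traceForm_iff] at h
    have : ∀ y : V, φ y = 1 := fun y => by
      rw [hφ, mul_comm, h _ y.2, AddChar.map_zero_eq_one]
    simp [this]
  · rw [mem_orthogonal_traceForm_iff] at h
    push Not at h
    obtain ⟨u, hu, hu0⟩ := h
    apply AddChar.sum_eq_zero_of_ne_one
    obtain ⟨c, hc⟩ := AddChar.ne_one_iff.1 hψ
    refine AddChar.ne_one_iff.2
      ⟨⟨(c / Algebra.trace F L (u * x)) • u, V.smul_mem _ hu⟩, ?_⟩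
    rw [hφ, mul_smul_comm, map_smul, mul_comm x, smul_eq_mul, div_mul_cancel₀ _ hu0]
    exact hc

/-! ### Quadratic character sums and squares in subspaces -/

open scoped Classical in
/-- The sum of the quadratic character over a subspace. -/
def quadraticCharSum [Fintype L] (U : Submodule F L) : ℤ := ∑ x : U, quadraticChar L x

open scoped Classical in
/-- Poisson summation for the quadratic character on a subspace of a field of square order. -/
theorem exists_sign_quadraticCharSum [Finite F] [Fintype L] {h : ℕ}
    (hF : Odd (Nat.card F)) (hL : Module.finrank F L = 2 * h) :
    ∃ ε : ℤ, (ε = 1 ∨ ε = -1) ∧ ∀ V : Submodule F L,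
      ε * (Nat.card F : ℤ) ^ h * quadraticCharSum V =
        (Nat.card F : ℤ) ^ Module.finrank F V *
          quadraticCharSum ((Algebra.traceForm F L).orthogonal V) := by
  have hcard : Fintype.card L = (Nat.card F ^ h) ^ 2 := by
    rw [← Nat.card_eq_fintype_card, Module.natCard_eq_pow_finrank (K := F), hL, mul_comm, pow_mul]
  have hchar : ringChar L ≠ 2 := by
    rw [Ne, FiniteField.even_card_iff_char_two, hcard, ← Nat.even_iff, Nat.not_even_iff_odd]
    exact (hF.pow).pow
  obtain ⟨ψ, hψ⟩ := AddChar.exists_apply_ne_zero.2 (one_ne_zero (α := F))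
  have hψ1 : ψ ≠ 1 := AddChar.ne_one_iff.2 ⟨1, hψ⟩
  let Ψ : AddChar L ℂ := ψ.compAddMonoidHom (Algebra.trace F L).toAddMonoidHom
  have hΨ : Ψ.IsPrimitive := by
    refine AddChar.IsPrimitive.of_ne_one (AddChar.ne_one_iff.2 ?_)
    obtain ⟨z, hz⟩ := Algebra.trace_surjective F L 1
    exact ⟨z, by change ψ (Algebra.trace F L z) ≠ 1; rwa [hz]⟩
  let χ : MulChar L ℂ := (quadraticChar L).ringHomComp (Int.castRingHom ℂ)
  have hχ1 : χ ≠ 1 :=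
    (MulChar.ringHomComp_ne_one_iff (RingHom.injective_int _)).2 (quadraticChar_ne_one hchar)
  have hχq : χ.IsQuadratic := (quadraticChar_isQuadratic L).comp _
  -- `|L|` is an odd square, hence `1` modulo `4`. So the squared Gauss sum is `|L|` itself, which
  -- leaves `± q ^ h`.
  have hneg : χ (-1) = 1 := by
    have : quadraticChar L (-1) = 1 := by
      rw [quadraticChar_one_iff_isSquare (neg_ne_zero.2 one_ne_zero),
        FiniteField.isSquare_neg_one_iff, hcard]
      obtain ⟨k, hk⟩ : Odd (Nat.card F ^ h) := hF.pow
      rw [hk]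
      ring_nf
      omega
    simp [χ, this]
  have hG : gaussSum χ Ψ = (Nat.card F : ℂ) ^ h ∨ gaussSum χ Ψ = -(Nat.card F : ℂ) ^ h := by
    apply sq_eq_sq_iff_eq_or_eq_neg.1
    rw [gaussSum_sq hχ1 hχq hΨ, hneg, one_mul, hcard]
    push_cast
    rfl
  -- The character `χ` is its own Fourier transform up to the Gauss sum; at `y = 0` both sides
  -- vanish.
  have hshift : ∀ y : L, ∑ x, χ x * Ψ (x * y) = χ y * gaussSum χ Ψ := by
    intro y
    rcases eq_or_ne y 0 with rfl | hy
    · simp [MulChar.sum_eq_zero_of_ne_one hχ1, MulChar.map_zero]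
    · have h1 := gaussSum_mulShift_eq χ Ψ (Units.mk0 y hy)
      rw [hχq.inv, Units.val_mk0] at h1
      rw [← h1]
      simp only [gaussSum, AddChar.mulShift_apply]
      exact Finset.sum_congr rfl fun x _ => by rw [mul_comm x]
  have hdual : ∀ V : Submodule F L, gaussSum χ Ψ * (quadraticCharSum V : ℂ) =
      (Nat.card F : ℂ) ^ Module.finrank F V *
        (quadraticCharSum ((Algebra.traceForm F L).orthogonal V) : ℂ) := by
    intro V
    calc gaussSum χ Ψ * (quadraticCharSum V : ℂ) = ∑ y : V, χ y * gaussSum χ Ψ := by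
          rw [← Finset.sum_mul, mul_comm, quadraticCharSum, Int.cast_sum]
          rfl
      _ = ∑ y : V, ∑ x, χ x * Ψ (x * y) := by simp_rw [hshift]
      _ = ∑ x, χ x * ∑ y : V, ψ (Algebra.trace F L (x * y)) := by
          rw [Finset.sum_comm]
          simp_rw [Finset.mul_sum]
          rfl
      _ = ∑ x, if x ∈ (Algebra.traceForm F L).orthogonal V
            then χ x * (Nat.card V : ℂ) else 0 := by
          simp_rw [sum_addChar_trace_mul hψ1, mul_ite, mul_zero]
      _ = (Nat.card V : ℂ) * ∑ x : (Algebra.traceForm F L).orthogonal V, χ x := by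
          rw [← Finset.sum_filter, ← Finset.sum_mul, mul_comm]
          congr 1
          exact Finset.sum_subtype _ (by simp) _
      _ = _ := by
          rw [natCard_submodule, quadraticCharSum, Int.cast_sum]
          push_cast
          rfl
  rcases hG with hG | hG
  · refine ⟨1, Or.inl rfl, fun V => ?_⟩
    have := hdual V
    rw [hG] at this
    rw [one_mul]
    exact_mod_cast this
  · refine ⟨-1, Or.inr rfl, fun V => ?_⟩
    have := hdual V
    rw [hG] at this
    rw [neg_one_mul]
    exact_mod_cast this

open scoped Classical in
/-- The number of nonzero squares in a subspace. -/
def squareCount [Fintype L] (U : Submodule F L) : ℕ :=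
  (Finset.univ.filter fun x : L => x ∈ U ∧ x ≠ 0 ∧ IsSquare x).card

open scoped Classical in
-- On nonzero elements `1 + χ` is twice the indicator of the squares; the `-1` removes the
-- contribution of `0`.
theorem two_mul_squareCount [Finite F] [Fintype L] (U : Submodule F L) :
    2 * (squareCount U : ℤ) =
      (Nat.card F : ℤ) ^ Module.finrank F U - 1 + quadraticCharSum U := by
  have h1 : ∀ x : L, (if x ∈ U then (if x = 0 then 0 else 1 + quadraticChar L x) else 0) =
      2 * (if x ∈ U ∧ x ≠ 0 ∧ IsSquare x then (1 : ℤ) else 0) := by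
    intro x
    rcases eq_or_ne x 0 with rfl | h0
    · simp
    by_cases hx : x ∈ U
    · by_cases hs : IsSquare x
      · simp [hx, h0, hs, (quadraticChar_one_iff_isSquare h0).2 hs]
      · simp [hx, h0, hs, quadraticChar_neg_one_iff_not_isSquare.2 hs]
    · simp [hx]
  have h2 := Finset.sum_congr (rfl : (Finset.univ : Finset L) = Finset.univ) fun x _ => h1 x
  rw [← Finset.mul_sum, Finset.sum_boole] at h2
  have h3 : (squareCount U : ℤ) = ((Finset.univ.filter fun x : L =>
      x ∈ U ∧ x ≠ 0 ∧ IsSquare x).card : ℤ) := rfl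
  rw [h3, ← h2, ← Finset.sum_filter,
    Finset.sum_subtype (p := (· ∈ U)) _ (by simp) (fun x => if x = 0 then 0 else 1 + quadraticChar L x)]
  have h4 : ∀ x : U, (if (x : L) = 0 then 0 else 1 + quadraticChar L x) =
      1 + quadraticChar L x - if x = 0 then 1 else 0 := by
    intro x
    by_cases h0 : x = 0
    · simp [h0]
    · have : (x : L) ≠ 0 := by simpa using h0
      simp [h0]
  simp_rw [h4]
  rw [Finset.sum_sub_distrib, Finset.sum_add_distrib, Finset.sum_ite_eq', if_pos (Finset.mem_univ _),
    quadraticCharSum]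
  have h5 : Fintype.card U = Nat.card F ^ Module.finrank F U := by
    rw [← natCard_submodule, Nat.card_eq_fintype_card]
  simp [h5]
  ring

theorem quadraticCharSum_le [Finite F] [Fintype L] {e : ℤ} (he : e = 1 ∨ e = -1)
    (U : Submodule F L) :
    e * quadraticCharSum U ≤ (Nat.card F : ℤ) ^ Module.finrank F U - 1 := by
  classical
  have hc : Fintype.card U = Nat.card F ^ Module.finrank F U := by
    rw [← natCard_submodule, Nat.card_eq_fintype_card]
  have h1 : ∀ x : U, e * quadraticChar L x ≤ 1 - if x = 0 then 1 else 0 := by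
    intro x
    by_cases h0 : x = 0
    · simp [h0]
    · have h0' : (x : L) ≠ 0 := by simpa using h0
      rcases he with rfl | rfl <;> rcases quadraticChar_dichotomy h0' with h | h <;> simp [h, h0]
  calc e * quadraticCharSum U = ∑ x : U, e * quadraticChar L x := by
        rw [quadraticCharSum, Finset.mul_sum]
    _ ≤ ∑ x : U, (1 - if x = 0 then 1 else 0) := Finset.sum_le_sum fun x _ => h1 x
    _ = _ := by
        rw [Finset.sum_sub_distrib, Finset.sum_ite_eq', if_pos (Finset.mem_univ _)]
        simp [hc]

open scoped Classical in
theorem quadraticCharSum_eq_of_forall [Finite F] [Fintype L] {e : ℤ} (U : Submodule F L)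
    (hU : ∀ x ∈ U, x ≠ 0 → quadraticChar L x = e) :
    quadraticCharSum U = e * ((Nat.card F : ℤ) ^ Module.finrank F U - 1) := by
  have hc : Fintype.card U = Nat.card F ^ Module.finrank F U := by
    rw [← natCard_submodule, Nat.card_eq_fintype_card]
  have h1 : ∀ x : U, quadraticChar L x = e * (1 - if x = 0 then 1 else 0) := by
    intro x
    by_cases h0 : x = 0
    · simp [h0]
    · have h0' : (x : L) ≠ 0 := by simpa using h0
      simp [hU x x.2 h0', h0]
  calc quadraticCharSum U = ∑ x : U, e * (1 - if x = 0 then 1 else 0) :=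
        Finset.sum_congr rfl fun x _ => h1 x
    _ = _ := by
        rw [← Finset.mul_sum, Finset.sum_sub_distrib, Finset.sum_ite_eq',
          if_pos (Finset.mem_univ _)]
        simp [hc]

open scoped Classical in
/-- The subfield of index two consists of squares. -/
theorem exists_submodule_forall_isSquare [Finite F] [Fintype L] {h : ℕ}
    (hF : Odd (Nat.card F)) (hL : Module.finrank F L = 2 * h) {d : ℕ} (hd : d ≤ h) :
    ∃ U : Submodule F L, Module.finrank F U = d ∧ ∀ x ∈ U, x ≠ 0 → quadraticChar L x = 1 := by
  have hcard : Fintype.card L = (Nat.card F ^ h) ^ 2 := by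
    rw [← Nat.card_eq_fintype_card, Module.natCard_eq_pow_finrank (K := F), hL, mul_comm, pow_mul]
  have hchar : ringChar L ≠ 2 := by
    rw [Ne, FiniteField.even_card_iff_char_two, hcard, ← Nat.even_iff, Nat.not_even_iff_odd]
    exact (hF.pow).pow
  have := Fintype.ofFinite F
  set Qh := Nat.card F ^ h with hQh
  obtain ⟨k, hk⟩ : Odd Qh := hF.pow
  -- The subfield of order `q ^ h`, as the fixed points of the `h`-th power of Frobenius.
  let W : Submodule F L := Subalgebra.toSubmodule
    (AlgHom.equalizer (FiniteField.frobeniusAlgHom F L ^ h) (AlgHom.id F L))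
  have hW : ∀ x, x ∈ W ↔ x ^ Qh = x := by
    intro x
    change (FiniteField.frobeniusAlgHom F L ^ h) x = x ↔ _
    rw [AlgHom.coe_pow, FiniteField.coe_frobeniusAlgHom, pow_iterate, hQh,
      Nat.card_eq_fintype_card]
  have hWu : ∀ x : Lˣ, (x : L) ∈ W ↔ x ^ (2 * k) = 1 := by
    intro x
    rw [hW, hk, pow_succ, ← Units.val_pow_eq_pow_val]
    rw [mul_eq_right₀ x.ne_zero, Units.val_eq_one]
  have hWcard : Nat.card W = Qh := by
    have h1 : Nat.card (powMonoidHom (2 * k) : Lˣ →* Lˣ).ker = 2 * k := by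
      rw [IsCyclic.card_powMonoidHom_ker, Nat.card_units, Nat.card_eq_fintype_card, hcard]
      apply Nat.gcd_eq_right
      rw [hk]
      exact ⟨2 * k + 2, by zify [show 1 ≤ (2 * k + 1) ^ 2 from Nat.one_le_pow _ _ (by omega)]; ring⟩
    have h2 : Nat.card W = Nat.card (powMonoidHom (2 * k) : Lˣ →* Lˣ).ker + 1 := by
      rw [← Finite.card_option]
      refine Nat.card_congr (Equiv.symm (Equiv.ofBijective
        (fun o => o.elim (0 : W) fun x => ⟨((x : Lˣ) : L), (hWu x).2 x.2⟩) ⟨?_, ?_⟩))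
      · rintro (_ | x) (_ | y) hxy
        · rfl
        · exact absurd (congrArg Subtype.val hxy).symm (y : Lˣ).ne_zero
        · exact absurd (congrArg Subtype.val hxy) (x : Lˣ).ne_zero
        · exact congrArg some (Subtype.ext (Units.ext (congrArg Subtype.val hxy)))
      · rintro ⟨w, hw⟩
        rcases eq_or_ne w 0 with rfl | h0
        · exact ⟨none, rfl⟩
        · exact ⟨some ⟨Units.mk0 w h0, (hWu (Units.mk0 w h0)).1 hw⟩, rfl⟩
    rw [h2, h1, hk]
  have hWdim : Module.finrank F W = h := by
    rw [natCard_submodule] at hWcard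
    exact Nat.pow_right_injective Finite.one_lt_card hWcard
  obtain ⟨U, hUW, hUd⟩ := exists_submodule_le_finrank_eq W (hd.trans hWdim.ge)
  refine ⟨U, hUd, fun x hx hx0 => ?_⟩
  rw [quadraticChar_one_iff_isSquare hx0, FiniteField.isSquare_iff hchar hx0, hcard]
  have hx1 : x ^ (2 * k) = 1 := by
    have := (hWu (Units.mk0 x hx0)).1 (hUW hx)
    simpa [Units.ext_iff] using this
  -- The exponent of Euler's criterion is a multiple of `2k = q ^ h - 1`, the order of the unit
  -- group of the subfield.
  have : Qh ^ 2 / 2 = 2 * k * (k + 1) := by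
    rw [hk, show (2 * k + 1) ^ 2 = 1 + 2 * (2 * k * (k + 1)) by ring]
    omega
  rw [this, pow_mul, hx1, one_pow]

open scoped Classical in
-- Multiplying a space of squares by a nonsquare flips the sign of the sum. Both signs are needed
-- because the sign of the Gauss sum stays undetermined.
theorem exists_submodule_quadraticCharSum [Finite F] [Fintype L] {h : ℕ}
    (hF : Odd (Nat.card F)) (hL : Module.finrank F L = 2 * h) {d : ℕ} (hd : d ≤ h)
    {e : ℤ} (he : e = 1 ∨ e = -1) :
    ∃ U : Submodule F L, Module.finrank F U = d ∧
      quadraticCharSum U = e * ((Nat.card F : ℤ) ^ d - 1) := by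
  obtain ⟨U, hUd, hU⟩ := exists_submodule_forall_isSquare hF hL hd
  rcases he with rfl | rfl
  · exact ⟨U, hUd, by rw [quadraticCharSum_eq_of_forall U hU, hUd]⟩
  · have hchar : ringChar L ≠ 2 := by
      rw [Ne, FiniteField.even_card_iff_char_two, ← Nat.card_eq_fintype_card,
        Module.natCard_eq_pow_finrank (K := F), ← Nat.even_iff, Nat.not_even_iff_odd]
      exact hF.pow
    obtain ⟨η, hη⟩ := quadraticChar_exists_neg_one' hchar
    have hinj : Function.Injective (LinearMap.mulLeft F (η : L)) :=
      mul_right_injective₀ η.ne_zero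
    have hdim : Module.finrank F (U.map (LinearMap.mulLeft F (η : L))) = d := by
      rw [← hUd]
      exact (Submodule.equivMapOfInjective _ hinj U).finrank_eq.symm
    refine ⟨U.map (LinearMap.mulLeft F (η : L)), hdim, ?_⟩
    rw [quadraticCharSum_eq_of_forall (e := -1), hdim]
    rintro _ ⟨x, hx, rfl⟩ hx0
    have hx0' : x ≠ 0 := by rintro rfl; simp at hx0
    rw [LinearMap.mulLeft_apply, map_mul, hη, hU x hx hx0', mul_one]

/-- Twice the largest number of nonzero squares in a `u`-dimensional subspace of a
`2h`-dimensional extension of a field with `q` elements. -/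
def squareBound (q h u : ℕ) : ℝ :=
  if u ≤ h then 2 * ((q : ℝ) ^ u - 1) else ((q : ℝ) ^ (u - h) + 1) * ((q : ℝ) ^ h - 1)

/-- For `dim U = h + c > h`, the trivial bound on `Uᗮ`, of dimension `d = h - c`, passes through
Poisson summation to `quadraticCharSum U ≤ q ^ h - q ^ c`. -/
theorem two_mul_squareCount_le [Finite F] [Fintype L] {h : ℕ}
    (hF : Odd (Nat.card F)) (hL : Module.finrank F L = 2 * h) (U : Submodule F L) :
    2 * (squareCount U : ℝ) ≤ squareBound (Nat.card F) h (Module.finrank F U) := by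
  have h2 := two_mul_squareCount U
  have h2' : 2 * (squareCount U : ℝ) =
      (Nat.card F : ℝ) ^ Module.finrank F U - 1 + quadraticCharSum U := by exact_mod_cast h2
  rw [h2', squareBound]
  split_ifs with hu
  · have h1 := quadraticCharSum_le (Or.inl rfl) U
    have h1' : (quadraticCharSum U : ℝ) ≤ (Nat.card F : ℝ) ^ Module.finrank F U - 1 := by
      rw [one_mul] at h1; exact_mod_cast h1
    linarith
  · obtain ⟨ε, hε, hdual⟩ := exists_sign_quadraticCharSum hF hL
    have h3 := hdual ((Algebra.traceForm F L).orthogonal U)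
    rw [orthogonal_orthogonal_traceForm, finrank_orthogonal_traceForm] at h3
    have h4 := quadraticCharSum_le hε ((Algebra.traceForm F L).orthogonal U)
    rw [finrank_orthogonal_traceForm] at h4
    have hle := Submodule.finrank_le U
    obtain ⟨c, hc⟩ : ∃ c, Module.finrank F U = h + c := ⟨_, (Nat.add_sub_of_le (by omega)).symm⟩
    obtain ⟨d, hd⟩ : ∃ d, h = c + d := ⟨h - c, by omega⟩
    rw [hL, hc, show 2 * h - (h + c) = d by omega] at h3 h4
    rw [hc, Nat.add_sub_cancel_left]
    have hq : (0 : ℝ) < (Nat.card F : ℝ) := by exact_mod_cast Nat.card_pos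
    have h3' : ((ε * quadraticCharSum ((Algebra.traceForm F L).orthogonal U) : ℤ) : ℝ) *
        (Nat.card F : ℝ) ^ h = (Nat.card F : ℝ) ^ d * quadraticCharSum U := by
      rw [mul_right_comm] at h3
      exact_mod_cast h3
    have h4' : ((ε * quadraticCharSum ((Algebra.traceForm F L).orthogonal U) : ℤ) : ℝ) ≤
        (Nat.card F : ℝ) ^ d - 1 := by exact_mod_cast h4
    have h5 : (Nat.card F : ℝ) ^ d * quadraticCharSum U ≤
        (Nat.card F : ℝ) ^ d * ((Nat.card F : ℝ) ^ h - (Nat.card F : ℝ) ^ c) := by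
      rw [← h3']
      refine (mul_le_mul_of_nonneg_right h4' (pow_pos hq h).le).trans (le_of_eq ?_)
      rw [hd, pow_add]
      ring
    have h6 := le_of_mul_le_mul_left h5 (pow_pos hq d)
    rw [pow_add]
    linarith

/-- Above dimension `h` the extremal space is the orthogonal of a space on which `χ` is constantly
`ε`, the sign of the Gauss sum. -/
theorem exists_two_mul_squareCount_eq [Finite F] [Fintype L] {h : ℕ}
    (hF : Odd (Nat.card F)) (hL : Module.finrank F L = 2 * h) {u : ℕ} (hu : u ≤ 2 * h) :
    ∃ U : Submodule F L, Module.finrank F U = u ∧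
      2 * (squareCount U : ℝ) = squareBound (Nat.card F) h u := by
  have h2 : ∀ U : Submodule F L, 2 * (squareCount U : ℝ) =
      (Nat.card F : ℝ) ^ Module.finrank F U - 1 + quadraticCharSum U := fun U => by
    exact_mod_cast two_mul_squareCount U
  rcases le_or_gt u h with huh | huh
  · obtain ⟨U, hUd, hU⟩ := exists_submodule_quadraticCharSum hF hL huh (Or.inl rfl)
    refine ⟨U, hUd, ?_⟩
    rw [h2, hU, hUd, squareBound, if_pos huh]
    push_cast
    ring
  · obtain ⟨ε, hε, hdual⟩ := exists_sign_quadraticCharSum hF hL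
    obtain ⟨c, rfl⟩ : ∃ c, u = h + c := ⟨_, (Nat.add_sub_of_le huh.le).symm⟩
    obtain ⟨d, hd⟩ : ∃ d, h = c + d := ⟨h - c, by omega⟩
    obtain ⟨V, hVd, hV⟩ :=
      exists_submodule_quadraticCharSum hF hL (show d ≤ h by omega) hε
    have hdim : Module.finrank F ((Algebra.traceForm F L).orthogonal V) = h + c := by
      rw [finrank_orthogonal_traceForm, hL, hVd]
      omega
    refine ⟨(Algebra.traceForm F L).orthogonal V, hdim, ?_⟩
    have h3 := hdual V
    have hε2 : ε * ε = 1 := by rcases hε with rfl | rfl <;> rfl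
    rw [hVd, hV, show ε * (Nat.card F : ℤ) ^ h * (ε * ((Nat.card F : ℤ) ^ d - 1)) =
      (ε * ε) * ((Nat.card F : ℤ) ^ h * ((Nat.card F : ℤ) ^ d - 1)) by ring, hε2, one_mul] at h3
    have h3' : (Nat.card F : ℝ) ^ h * ((Nat.card F : ℝ) ^ d - 1) = (Nat.card F : ℝ) ^ d *
        quadraticCharSum ((Algebra.traceForm F L).orthogonal V) := by exact_mod_cast h3
    have hq : (0 : ℝ) < (Nat.card F : ℝ) ^ d := pow_pos (by exact_mod_cast Nat.card_pos) d
    have h4 : (quadraticCharSum ((Algebra.traceForm F L).orthogonal V) : ℝ) =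
        (Nat.card F : ℝ) ^ h - (Nat.card F : ℝ) ^ c := by
      apply mul_left_cancel₀ hq.ne'
      rw [← h3', hd, pow_add]
      ring
    rw [h2, hdim, h4, squareBound, if_neg (by omega), Nat.add_sub_cancel_left, pow_add]
    ring

/-! ### Equidistribution of powers modulo scalars -/

open scoped Classical in
-- All fibres over the range have the size of the kernel.
theorem MonoidHom.card_filter_comp_mul_card_range {G H : Type*} [Group G] [Group H] [Fintype G]
    [Fintype H] (f : G →* H) {R : Subgroup H} (hR : f.range = R) (P : H → Prop) :
    (Finset.univ.filter fun g => P (f g)).card * Nat.card R =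
      Nat.card G * (Finset.univ.filter fun h => P h ∧ h ∈ R).card := by
  have key : ∀ P : H → Prop, (Finset.univ.filter fun g => P (f g)).card =
      (Finset.univ.filter fun h => P h ∧ h ∈ R).card *
        (Finset.univ.filter fun g => f g = 1).card := by
    intro P
    rw [Finset.card_eq_sum_card_fiberwise (f := f)
      (t := Finset.univ.filter fun h => P h ∧ h ∈ R)]
    · refine Finset.sum_const_nat fun h hh => ?_
      rw [Finset.mem_filter] at hh
      have hhf : h ∈ f.range := hR ▸ hh.2.2
      rw [Finset.filter_filter, ← MonoidHom.card_fiber_eq_of_mem_range f hhf ⟨1, map_one f⟩]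
      congr 1
      ext g
      simp only [Finset.mem_filter, Finset.mem_univ, true_and, and_iff_right_iff_imp]
      rintro rfl
      exact hh.2.1
    · intro g hg
      simp only [Finset.coe_filter, Finset.mem_univ, true_and, Set.mem_ofPred_eq] at hg ⊢
      exact ⟨hg, hR ▸ ⟨g, rfl⟩⟩
  have h1 := key fun _ => True
  simp only [true_and, Finset.filter_true, Finset.card_univ] at h1
  have h2 : Nat.card R = (Finset.univ.filter fun h => h ∈ R).card := by
    rw [Nat.card_eq_fintype_card, Fintype.card_subtype]
  rw [key P, h2, Nat.card_eq_fintype_card, h1]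
  ring

theorem sum_range_card_pow_eq_sum {G M : Type*} [Group G] [Fintype G] [AddCommMonoid M] {g : G}
    (hg : ∀ x, x ∈ Subgroup.zpowers g) (f : G → M) :
    ∑ l ∈ Finset.range (Nat.card G), f (g ^ l) = ∑ x, f x := by
  classical
  rw [← IsCyclic.image_range_card hg, Finset.sum_image]
  intro i hi j hj hij
  rw [← orderOf_eq_card_of_forall_mem_zpowers hg] at hi hj
  exact pow_injOn_Iio_orderOf (by simpa using hi) (by simpa using hj) hij

/-- Both are subgroups of order `q - 1` in a cyclic group. -/
theorem mem_range_unitsMap_algebraMap_iff [Finite F] [Finite L] {γ : Lˣ}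
    (hγ : ∀ x, x ∈ Subgroup.zpowers γ) {k : ℕ} (hk : k * (Nat.card F - 1) = Nat.card L - 1)
    (x : Lˣ) :
    x ∈ (Units.map (algebraMap F L).toMonoidHom).range ↔ x ∈ Subgroup.zpowers (γ ^ k) := by
  have hF1 : 0 < Nat.card F - 1 := Nat.sub_pos_of_lt Finite.one_lt_card
  have hL1 : 0 < Nat.card L - 1 := Nat.sub_pos_of_lt Finite.one_lt_card
  have hord : orderOf γ = Nat.card L - 1 := by
    rw [orderOf_eq_card_of_forall_mem_zpowers hγ, Nat.card_units]
  have hk0 : k ≠ 0 := by rintro rfl; omega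
  have heq : (Units.map (algebraMap F L).toMonoidHom).range = Subgroup.zpowers (γ ^ k) := by
    apply Subgroup.eq_of_le_of_card_ge
    · rintro _ ⟨c, rfl⟩
      obtain ⟨j, hj⟩ := hγ (Units.map (algebraMap F L).toMonoidHom c)
      have h1 : γ ^ (j * ((Nat.card F - 1 : ℕ) : ℤ)) = 1 := by
        have hj' : γ ^ j = Units.map (algebraMap F L).toMonoidHom c := hj
        rw [zpow_mul, hj', zpow_natCast, ← map_pow, ← Nat.card_units, pow_card_eq_one', map_one]
      rw [← orderOf_dvd_iff_zpow_eq_one, hord, ← hk] at h1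
      push_cast at h1
      obtain ⟨i, hi⟩ := Int.dvd_of_mul_dvd_mul_right (by exact_mod_cast hF1.ne') h1
      refine ⟨i, ?_⟩
      change (γ ^ k) ^ i = _
      rw [← hj, hi, ← zpow_natCast, ← zpow_mul]
    · have hinj : Function.Injective (Units.map (algebraMap F L).toMonoidHom) :=
        Units.map_injective (algebraMap F L).injective
      rw [Nat.card_zpowers, orderOf_pow_of_dvd hk0 (hord ▸ ⟨_, hk.symm⟩), hord, ← hk,
        Nat.mul_div_cancel_left _ (Nat.pos_of_ne_zero hk0), ← Nat.card_units,
        Nat.card_congr (MonoidHom.ofInjective hinj).toEquiv]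
  rw [heq]

open scoped Classical in
/-- The values of `x ↦ x ^ b` are equidistributed, up to scalars, over a subgroup of index
`gcd (k, b)`. -/
theorem card_filter_zpow_eq_mul [Finite F] [Fintype L] {γ : Lˣ}
    (hγ : ∀ x, x ∈ Subgroup.zpowers γ) {k : ℕ} (hk : k * (Nat.card F - 1) = Nat.card L - 1)
    {b : ℤ} {N : ℕ} (hN : N = Int.gcd k b) (P : Lˣ → Prop)
    (hP : ∀ (c : Fˣ) x, P (Units.map (algebraMap F L).toMonoidHom c * x) ↔ P x) :
    (Finset.univ.filter fun x : Lˣ => P (x ^ b)).card =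
      N * (Finset.univ.filter fun x : Lˣ => P x ∧ x ∈ Subgroup.zpowers (γ ^ N)).card := by
  have := Fintype.ofFinite F
  have hF1 : 0 < Nat.card F - 1 := Nat.sub_pos_of_lt Finite.one_lt_card
  have hL1 : 0 < Nat.card L - 1 := Nat.sub_pos_of_lt Finite.one_lt_card
  have hord : orderOf γ = Nat.card L - 1 := by
    rw [orderOf_eq_card_of_forall_mem_zpowers hγ, Nat.card_units]
  have hk0 : k ≠ 0 := by rintro rfl; omega
  have hN0 : N ≠ 0 := by
    rw [hN, Ne, Int.gcd_eq_zero_iff]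
    simp [hk0]
  have hNk : N ∣ k := by
    have := Int.gcd_dvd_left (k : ℤ) b
    rw [← hN] at this
    exact_mod_cast this
  have hNb : (N : ℤ) ∣ b := hN ▸ Int.gcd_dvd_right _ _
  have hNL : N ∣ Nat.card L - 1 := hk ▸ hNk.mul_right _
  let ι : Fˣ →* Lˣ := Units.map (algebraMap F L).toMonoidHom
  -- As `Fˣ = ⟨γ ^ k⟩`, Bézout gives this homomorphism the image `⟨γ ^ N⟩`. Scalar invariance of `P`
  -- then makes the count over the pairs `q - 1` times the count over `x`.
  let φ : Fˣ × Lˣ →* Lˣ := ι.coprod (zpowGroupHom b)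
  have hφ : ∀ c x, φ (c, x) = ι c * x ^ b := fun _ _ => rfl
  have hrange : φ.range = Subgroup.zpowers (γ ^ N) := by
    apply le_antisymm
    · rintro _ ⟨⟨c, x⟩, rfl⟩
      obtain ⟨i, hi⟩ := (mem_range_unitsMap_algebraMap_iff hγ hk (ι c)).1 ⟨c, rfl⟩
      obtain ⟨j, rfl⟩ := hγ x
      obtain ⟨k', rfl⟩ := hNk
      obtain ⟨b', rfl⟩ := hNb
      refine ⟨k' * i + b' * j, ?_⟩
      have hi' : (γ ^ (N * k')) ^ i = ι c := hi
      change (γ ^ N) ^ ((k' : ℤ) * i + b' * j) = ι c * (γ ^ j) ^ ((N : ℤ) * b')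
      rw [← hi', ← zpow_natCast γ N, ← zpow_natCast γ (N * k'), ← zpow_mul, ← zpow_mul,
        ← zpow_mul, ← zpow_add]
      congr 1
      push_cast
      ring
    · rw [Subgroup.zpowers_le]
      obtain ⟨c, hc⟩ := (mem_range_unitsMap_algebraMap_iff (F := F) hγ hk
        (γ ^ ((k : ℤ) * Int.gcdA k b))).2 ⟨Int.gcdA k b, by
          change (γ ^ k) ^ _ = _
          rw [zpow_mul, zpow_natCast]⟩
      refine ⟨(c, γ ^ Int.gcdB k b), ?_⟩
      have hc' : ι c = γ ^ ((k : ℤ) * Int.gcdA k b) := hc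
      rw [hφ, hc', ← zpow_mul, ← zpow_add, ← zpow_natCast, hN, Int.gcd_eq_gcd_ab,
        mul_comm (Int.gcdB _ _)]
  have hcount := φ.card_filter_comp_mul_card_range hrange P
  have hprod : (Finset.univ.filter fun g : Fˣ × Lˣ => P (φ g)) =
      (Finset.univ : Finset Fˣ) ×ˢ (Finset.univ.filter fun x : Lˣ => P (x ^ b)) := by
    ext ⟨c, x⟩
    simp only [Finset.mem_filter, Finset.mem_univ, true_and, Finset.mem_product, hφ]
    exact hP c _
  have hR : Nat.card (Subgroup.zpowers (γ ^ N)) * N = Nat.card L - 1 := by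
    rw [Nat.card_zpowers, orderOf_pow_of_dvd hN0 (hord ▸ hNL), hord,
      Nat.div_mul_cancel hNL]
  have hRpos : 0 < Nat.card (Subgroup.zpowers (γ ^ N)) := Nat.card_pos
  rw [hprod, Finset.card_product, Finset.card_univ, ← Nat.card_eq_fintype_card,
    Nat.card_prod, Nat.card_units, Nat.card_units, ← hR] at hcount
  refine Nat.eq_of_mul_eq_mul_left (Nat.mul_pos hF1 hRpos) ?_
  calc _ = _ := by ring
    _ = _ := hcount
    _ = _ := by ring

open scoped Classical in
/-- The number of `x` at which some word `(Tr (u x ^ b))_x`, `u ∈ U`, does not vanish. -/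
def unitWeight [Fintype L] (b : ℤ) (U : Submodule F L) : ℕ :=
  (Finset.univ.filter fun x : Lˣ => ∃ u ∈ U, Algebra.trace F L (u * ((x ^ b : Lˣ) : L)) ≠ 0).card

open scoped Classical in
/-- The number of elements of the subgroup generated by `g` in a subspace. -/
def zpowersCount [Fintype L] (g : Lˣ) (U : Submodule F L) : ℕ :=
  (Finset.univ.filter fun x : Lˣ => (x : L) ∈ U ∧ x ∈ Subgroup.zpowers g).card

/-- The position `x` lies outside the support exactly when `x ^ b ∈ Uᗮ`, a condition invariant under
scalars. -/
theorem unitWeight_add [Finite F] [Fintype L] {γ : Lˣ}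
    (hγ : ∀ x, x ∈ Subgroup.zpowers γ) {k : ℕ} (hk : k * (Nat.card F - 1) = Nat.card L - 1)
    {b : ℤ} {N : ℕ} (hN : N = Int.gcd k b) (U : Submodule F L) :
    unitWeight b U + N * zpowersCount (γ ^ N) ((Algebra.traceForm F L).orthogonal U) =
      Nat.card L - 1 := by
  classical
  have h1 := card_filter_zpow_eq_mul hγ hk hN
    (fun x : Lˣ => (x : L) ∈ (Algebra.traceForm F L).orthogonal U) (fun c x => by
      have : ((Units.map (algebraMap F L).toMonoidHom c * x : Lˣ) : L) = (c : F) • (x : L) := by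
        rw [Algebra.smul_def]; rfl
      rw [this]
      exact Submodule.smul_mem_iff _ c.ne_zero)
  have h2 : (Finset.univ.filter fun x : Lˣ =>
      ((x ^ b : Lˣ) : L) ∈ (Algebra.traceForm F L).orthogonal U) =
      Finset.univ.filter fun x : Lˣ =>
        ¬ ∃ u ∈ U, Algebra.trace F L (u * ((x ^ b : Lˣ) : L)) ≠ 0 := by
    refine Finset.filter_congr fun x _ => ?_
    rw [mem_orthogonal_traceForm_iff]
    push Not
    rfl
  rw [unitWeight, zpowersCount, ← h1, h2, Finset.card_filter_add_card_filter_not,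
    Finset.card_univ, ← Nat.card_eq_fintype_card, Nat.card_units]

theorem zpowersCount_generator [Finite F] [Fintype L] {γ : Lˣ}
    (hγ : ∀ x, x ∈ Subgroup.zpowers γ) (U : Submodule F L) :
    zpowersCount γ U + 1 = Nat.card F ^ Module.finrank F U := by
  classical
  rw [← natCard_submodule, zpowersCount, ← Fintype.card_subtype, ← Nat.card_eq_fintype_card,
    ← Finite.card_option]
  refine Nat.card_congr (Equiv.ofBijective
    (fun o => o.elim (0 : U) fun x => ⟨((x : Lˣ) : L), x.2.1⟩) ⟨?_, ?_⟩)
  · rintro (_ | x) (_ | y) hxy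
    · rfl
    · exact absurd (congrArg Subtype.val hxy).symm (y : Lˣ).ne_zero
    · exact absurd (congrArg Subtype.val hxy) (x : Lˣ).ne_zero
    · exact congrArg some (Subtype.ext (Units.ext (congrArg Subtype.val hxy)))
  · rintro ⟨w, hw⟩
    rcases eq_or_ne w 0 with rfl | h0
    · exact ⟨none, rfl⟩
    · exact ⟨some ⟨Units.mk0 w h0, hw, hγ _⟩, rfl⟩

theorem zpowersCount_sq_generator [Fintype L] {γ : Lˣ}
    (hγ : ∀ x, x ∈ Subgroup.zpowers γ) (U : Submodule F L) :
    zpowersCount (γ ^ 2) U = squareCount U := by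
  classical
  have hsq : ∀ x : Lˣ, x ∈ Subgroup.zpowers (γ ^ 2) ↔ IsSquare (x : L) := by
    intro x
    constructor
    · rintro ⟨i, rfl⟩
      refine ⟨((γ ^ i : Lˣ) : L), ?_⟩
      rw [← Units.val_mul, ← zpow_add]
      change (((γ ^ 2) ^ i : Lˣ) : L) = _
      rw [← zpow_natCast, ← zpow_mul]
      congr 2
      push_cast
      ring
    · rintro ⟨y, hy⟩
      have hy0 : y ≠ 0 := by
        rintro rfl
        exact x.ne_zero (by rw [hy, mul_zero])
      obtain ⟨i, hi⟩ := hγ (Units.mk0 y hy0)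
      have hi' : γ ^ i = Units.mk0 y hy0 := hi
      refine ⟨i, ?_⟩
      change (γ ^ 2) ^ i = x
      rw [← zpow_natCast, ← zpow_mul, mul_comm, zpow_mul, hi']
      ext
      rw [hy, zpow_natCast, Units.val_pow_eq_pow_val, Units.val_mk0]
      ring
  rw [zpowersCount, squareCount]
  refine Finset.card_bij (fun x _ => (x : L)) ?_ ?_ ?_
  · intro x hx
    simp only [Finset.mem_filter, Finset.mem_univ, true_and] at hx ⊢
    exact ⟨hx.1, x.ne_zero, (hsq x).1 hx.2⟩
  · intro x _ y _ hxy
    exact Units.ext hxy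
  · intro x hx
    simp only [Finset.mem_filter, Finset.mem_univ, true_and] at hx
    exact ⟨Units.mk0 x hx.2.1, by simp [hsq, hx.1, hx.2.2], rfl⟩

/-! ### Splitting the support by Fourier coordinates -/

open scoped Classical in
theorem ncard_codeSupport_map_traceCode {ι : Type*} [Fintype ι] (n : ℕ) (α : ι → Lˣ)
    (V : Submodule F (ι → L)) :
    (codeSupport (V.map (traceCode F n α))).ncard = ∑ j ∈ Finset.range n,
      if ∃ x ∈ V, Algebra.trace F L (∑ i, x i * (α i : L) ^ j) ≠ 0 then 1 else 0 := by
  rw [Finset.sum_range (fun j =>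
    if ∃ x ∈ V, Algebra.trace F L (∑ i, x i * (α i : L) ^ j) ≠ 0 then 1 else 0),
    Finset.sum_boole, Nat.cast_id, ← Set.ncard_coe_finset]
  congr 1
  ext j
  simp [codeSupport, traceCode_apply]

/-- The twisted discrete Fourier coordinate `x ↦ g ^ k * ∑ i, x i * v i ^ k`. -/
def fourierCoord (F : Type*) {L ι : Type*} [Field F] [Field L] [Algebra F L] [Fintype ι]
    (g : Lˣ) (v : ι → Lˣ) (k : ℕ) : (ι → L) →ₗ[F] L :=
  LinearMap.mulLeft F ((g : L) ^ k) ∘ₗ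
    ∑ i, LinearMap.mulRight F ((v i : L) ^ k) ∘ₗ LinearMap.proj i

theorem fourierCoord_apply {ι : Type*} [Fintype ι] (g : Lˣ) (v : ι → Lˣ) (k : ℕ) (x : ι → L) :
    fourierCoord F g v k x = (g : L) ^ k * ∑ i, x i * (v i : L) ^ k := by
  simp [fourierCoord, Finset.mul_sum]

theorem pi_fourierCoord_injective {t : ℕ} (g : Lˣ) {v : Fin t → Lˣ} (hv : Function.Injective v) :
    Function.Injective (LinearMap.pi fun k : Fin t => fourierCoord F g v k) := by
  rw [injective_iff_map_eq_zero]
  intro x hx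
  refine Matrix.eq_zero_of_forall_pow_sum_mul_pow_eq_zero (f := fun i => (v i : L))
    (fun i j hij => hv (Units.ext hij)) fun k => ?_
  have := congrFun hx k
  rw [LinearMap.pi_apply, fourierCoord_apply] at this
  exact (mul_eq_zero.1 this).resolve_left (pow_ne_zero _ g.ne_zero)

/-- The support of a subcode splits along the Fourier coordinates. -/
theorem mul_ncard_codeSupport [Fintype L] {γ : Lˣ} (hγ : ∀ x, x ∈ Subgroup.zpowers γ)
    {t M n δ : ℕ} (htM : t * M = Nat.card L - 1) (hnδ : n * δ = Nat.card L - 1)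
    {α v : Fin t → Lˣ} (hα : ∀ i, α i ^ n = 1) {a : ℤ} (hαv : ∀ i, α i = γ ^ a * v i)
    (hv : ∀ i, v i ^ t = 1) (V : Submodule F (Fin t → L)) :
    t * δ * (codeSupport (V.map (traceCode F n α))).ncard =
      ∑ k : Fin t, unitWeight (a * t) (V.map (fourierCoord F (γ ^ a) v k)) := by
  classical
  set f : ℕ → ℕ := fun j =>
    if ∃ x ∈ V, Algebra.trace F L (∑ i, x i * (α i : L) ^ j) ≠ 0 then 1 else 0 with hf
  have hcardu : Nat.card Lˣ = Nat.card L - 1 := Nat.card_units L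
  have hfn : ∀ j, f (j + n) = f j := by
    intro j
    have : ∀ i, (α i : L) ^ (j + n) = (α i : L) ^ j := fun i => by
      rw [pow_add, ← Units.val_pow_eq_pow_val _ n, hα, Units.val_one, mul_one]
    simp only [hf, this]
  have hsplit : ∀ k l, f (k + t * l) = if ∃ u ∈ V.map (fourierCoord F (γ ^ a) v k),
      Algebra.trace F L (u * (((γ ^ l) ^ (a * t) : Lˣ) : L)) ≠ 0 then 1 else 0 := by
    intro k l
    have h1 : ∀ x : Fin t → L, ∑ i, x i * (α i : L) ^ (k + t * l) =
        fourierCoord F (γ ^ a) v k x * (((γ ^ l) ^ (a * t) : Lˣ) : L) := by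
      intro x
      rw [fourierCoord_apply, Finset.mul_sum, Finset.sum_mul]
      refine Finset.sum_congr rfl fun i _ => ?_
      have h2 : α i ^ (k + t * l) = (γ ^ a) ^ k * v i ^ k * (γ ^ l) ^ (a * t) := by
        rw [hαv, mul_pow, pow_add (v i), pow_mul (v i), hv, one_pow, mul_one, pow_add,
          mul_right_comm]
        congr 1
        rw [← zpow_natCast, ← zpow_natCast, ← zpow_mul, ← zpow_mul]
        congr 1
        push_cast
        ring
      have h3 := congrArg Units.val h2
      push_cast at h3 ⊢
      rw [h3]
      ring
    simp only [hf, h1, Submodule.mem_map, exists_exists_and_eq_and]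
  have hγM : ∀ l, γ ^ (l + M) = γ ^ l * γ ^ M := fun l => pow_add _ _ _
  have hweight : ∀ k : ℕ, t * ∑ l ∈ Finset.range M, f (k + t * l) =
      unitWeight (a * t) (V.map (fourierCoord F (γ ^ a) v k)) := by
    intro k
    -- The summand has period `M` in `l`, so `t` periods run through all of `Lˣ`.
    rw [← sum_range_mul_of_periodic (f := fun l => f (k + t * l))]
    · rw [mul_comm M t, htM, ← hcardu]
      simp_rw [hsplit]
      rw [sum_range_card_pow_eq_sum hγ (fun x : Lˣ =>
        if ∃ u ∈ V.map (fourierCoord F (γ ^ a) v k),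
          Algebra.trace F L (u * ((x ^ (a * t) : Lˣ) : L)) ≠ 0 then 1 else 0),
        Finset.sum_boole, Nat.cast_id, unitWeight]
    · intro l
      have : (γ ^ M) ^ (a * t) = 1 := by
        rw [← zpow_natCast, ← zpow_mul, show (M : ℤ) * (a * t) = ((t * M : ℕ) : ℤ) * a by
          push_cast; ring, zpow_mul, zpow_natCast, htM, ← hcardu, pow_card_eq_one', one_zpow]
      simp only [hsplit, hγM, mul_zpow, this, mul_one]
  have hcount : (codeSupport (V.map (traceCode F n α))).ncard = ∑ j ∈ Finset.range n, f j := by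
    convert ncard_codeSupport_map_traceCode n α V
  -- `δ` periods of length `n` fill the range `Q - 1 = t M`, which splits into residue classes
  -- modulo `t`.
  rw [hcount, mul_assoc, ← sum_range_mul_of_periodic hfn, hnδ, ← htM,
    sum_range_mul_eq_sum_sum, Finset.mul_sum]
  simp_rw [hweight]
  rw [Finset.sum_range (fun k => unitWeight (a * t) (V.map (fourierCoord F (γ ^ a) v k)))]

theorem sum_fin_step {M : Type*} [AddCommMonoid M] (g : ℕ → M) {t s m u : ℕ} (hs : s < t) :
    ∑ k : Fin t, g (if (k : ℕ) < s then m else if (k : ℕ) = s then u else 0) =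
      s • g m + g u + (t - s - 1) • g 0 := by
  rw [Fin.sum_univ_eq_sum_range (fun k => g (if k < s then m else if k = s then u else 0))]
  obtain ⟨c, rfl⟩ : ∃ c, t = s + 1 + c := ⟨t - s - 1, by omega⟩
  rw [Finset.sum_range_add, Finset.sum_range_succ]
  congr 1
  · congr 1
    · rw [Finset.sum_congr rfl fun k hk => by rw [if_pos (Finset.mem_range.1 hk)]]
      simp
    · simp
  · rw [Finset.sum_congr rfl fun k _ => by
      rw [if_neg (by omega : ¬ s + 1 + k < s), if_neg (by omega : ¬ s + 1 + k = s)]]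
    simp [show s + 1 + c - s - 1 = c by omega]

/-! ### The weight hierarchy from a convex sharp bound -/

/-- Isolates what the cases `N = 1` and `N = 2` share: `B` is convex, bounds `N |U ∩ ⟨γ ^ N⟩|` by
the dimension of `U`, and is attained in every dimension. -/
theorem genHammingWeight_range_traceCode [Finite F] [Fintype L] {γ : Lˣ}
    (hγ : ∀ x, x ∈ Subgroup.zpowers γ)
    {t M n δ k N : ℕ} (htM : t * M = Nat.card L - 1) (hnδ : n * δ = Nat.card L - 1)
    {α v : Fin t → Lˣ} (hα : ∀ i, α i ^ n = 1) {a : ℤ} (hαv : ∀ i, α i = γ ^ a * v i)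
    (hv : ∀ i, v i ^ t = 1) (hvinj : Function.Injective v)
    (hinj : Function.Injective (traceCode F n α))
    (hk : k * (Nat.card F - 1) = Nat.card L - 1) (hN : N = Int.gcd k (a * t))
    {B : ℕ → ℝ} (hB0 : B 0 = 0) (hB1 : 0 ≤ B 1)
    (hB : ∀ i, i + 2 ≤ Module.finrank F L → B (i + 1) - B i ≤ B (i + 2) - B (i + 1))
    (hBm : B (Module.finrank F L) = (Nat.card L : ℝ) - 1)
    (hBle : ∀ U : Submodule F L,
      (N : ℝ) * zpowersCount (γ ^ N) U ≤ B (Module.finrank F U))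
    (hBex : ∀ u, u ≤ Module.finrank F L → ∃ U : Submodule F L, Module.finrank F U = u ∧
      (N : ℝ) * zpowersCount (γ ^ N) U = B u)
    {s r u : ℕ} (hs : s < t) (hu : u < Module.finrank F L)
    (hr : r + s * Module.finrank F L + u = t * Module.finrank F L) :
    (t : ℝ) * δ * genHammingWeight (LinearMap.range (traceCode F n α)) r =
      ((t : ℝ) - s) * ((Nat.card L : ℝ) - 1) - B u := by
  set m := Module.finrank F L with hm
  have hL1 : 1 < Nat.card L := Finite.one_lt_card
  have hweight : ∀ U : Submodule F L, (unitWeight (a * t) U : ℝ) = (Nat.card L : ℝ) - 1 -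
      N * zpowersCount (γ ^ N) ((Algebra.traceForm F L).orthogonal U) := by
    intro U
    have h := unitWeight_add hγ hk hN U
    have h' : ((unitWeight (a * t) U +
        N * zpowersCount (γ ^ N) ((Algebra.traceForm F L).orthogonal U) : ℕ) : ℝ) =
        ((Nat.card L - 1 : ℕ) : ℝ) := by rw [h]
    rw [Nat.cast_sub hL1.le] at h'
    push_cast at h'
    linarith
  have hsupp : ∀ V : Submodule F (Fin t → L),
      (t : ℝ) * δ * (codeSupport (V.map (traceCode F n α))).ncard =
        ∑ k : Fin t, (unitWeight (a * t) (V.map (fourierCoord F (γ ^ a) v k)) : ℝ) := by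
    intro V
    exact_mod_cast mul_ncard_codeSupport hγ htM hnδ hα hαv hv V
  let z : (Fin t → L) ≃ₗ[F] (Fin t → L) := LinearEquiv.ofInjectiveEndo
    (LinearMap.pi fun k : Fin t => fourierCoord F (γ ^ a) v k) (pi_fourierCoord_injective _ hvinj)
  have hz : ∀ x k, z x k = fourierCoord F (γ ^ a) v k x := fun _ _ => rfl
  set S := {w | ∃ D : Submodule F (Fin n → F), D ≤ LinearMap.range (traceCode F n α) ∧
    Module.finrank F D = r ∧ w = (codeSupport D).ncard} with hS
  have hlower : ∀ w ∈ S, ((t : ℝ) - s) * ((Nat.card L : ℝ) - 1) - B u ≤ (t : ℝ) * δ * w := by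
    rintro w ⟨D, hDC, hDr, rfl⟩
    obtain ⟨V, rfl⟩ : ∃ V : Submodule F (Fin t → L), V.map (traceCode F n α) = D :=
      ⟨D.comap (traceCode F n α), Submodule.map_comap_eq_of_le hDC⟩
    have hVr : Module.finrank F V = r := by
      rw [← hDr]
      exact (Submodule.equivMapOfInjective _ hinj V).finrank_eq
    have hdim : r ≤ ∑ k : Fin t, Module.finrank F (V.map (fourierCoord F (γ ^ a) v k)) := by
      -- `V` embeds in the product of its coordinate images, so their dimensions add up to at least
      -- `r`.
      let ρ : V →ₗ[F] (∀ k : Fin t, V.map (fourierCoord F (γ ^ a) v k)) :=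
        LinearMap.pi fun k => (fourierCoord F (γ ^ a) v k).submoduleMap V
      have hρ : Function.Injective ρ := by
        intro x y hxy
        apply Subtype.ext
        apply z.injective
        funext k
        exact congrArg Subtype.val (congrFun hxy k)
      rw [← hVr, ← Module.finrank_pi_fintype]
      exact LinearMap.finrank_le_finrank_of_injective hρ
    rw [hsupp]
    set d : Fin t → ℕ := fun k => Module.finrank F (V.map (fourierCoord F (γ ^ a) v k)) with hd
    have hdm : ∀ k, d k ≤ m := fun k => Submodule.finrank_le _
    have hsum : ∑ k, (m - d k) ≤ s * m + u := by
      have h1 : ∑ k, (m - d k) + ∑ k, d k = t * m := by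
        rw [← Finset.sum_add_distrib, Finset.sum_congr rfl fun k _ => Nat.sub_add_cancel (hdm k)]
        simp
      have h2 : r ≤ ∑ k, d k := hdim
      omega
    have hconv := sum_le_of_increments_monotone (by omega) hB0 hB1 hB Finset.univ
      (fun k => m - d k) (fun k _ => Nat.sub_le _ _) hu hsum
    calc ((t : ℝ) - s) * ((Nat.card L : ℝ) - 1) - B u
        = t * ((Nat.card L : ℝ) - 1) - (s * B m + B u) := by rw [hBm]; ring
      _ ≤ t * ((Nat.card L : ℝ) - 1) - ∑ k, B (m - d k) := by linarith
      _ = ∑ k, ((Nat.card L : ℝ) - 1 - B (m - d k)) := by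
          rw [Finset.sum_sub_distrib, Finset.sum_const, Finset.card_fin, nsmul_eq_mul]
      _ ≤ _ := by
          refine Finset.sum_le_sum fun k _ => ?_
          rw [hweight]
          have := hBle ((Algebra.traceForm F L).orthogonal (V.map (fourierCoord F (γ ^ a) v k)))
          rw [finrank_orthogonal_traceForm] at this
          linarith
  have hupper : ∃ w ∈ S, (t : ℝ) * δ * w = ((t : ℝ) - s) * ((Nat.card L : ℝ) - 1) - B u := by
    -- Prescribed codimensions of the coordinate images: `s` times `m`, once `u`, otherwise `0`. The
    -- extremal `V` is the preimage under `z` of the product of orthogonals of extremal spaces.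
    set e : Fin t → ℕ := fun k => if (k : ℕ) < s then m else if (k : ℕ) = s then u else 0 with he
    have hem : ∀ k, e k ≤ m := fun k => by
      simp only [he]
      split_ifs <;> omega
    choose U hUd hUB using fun k => hBex (e k) (hem k)
    let Y : Fin t → Submodule F L := fun k => (Algebra.traceForm F L).orthogonal (U k)
    let ι : (∀ k, Y k) →ₗ[F] (Fin t → L) :=
      LinearMap.pi fun k => (Y k).subtype ∘ₗ LinearMap.proj k
    have hι : ∀ y k, ι y k = y k := fun _ _ => rfl
    have hιinj : Function.Injective ι := fun x y hxy =>
      funext fun k => Subtype.ext (congrFun hxy k)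
    let V : Submodule F (Fin t → L) := LinearMap.range (z.symm.toLinearMap ∘ₗ ι)
    have hVk : ∀ k : Fin t, V.map (fourierCoord F (γ ^ a) v k) = Y k := by
      intro k
      ext x
      constructor
      · rintro ⟨_, ⟨y, rfl⟩, rfl⟩
        rw [← hz]
        change z (z.symm (ι y)) k ∈ Y k
        rw [z.apply_symm_apply]
        exact (y k).2
      · intro hx
        refine ⟨z.symm (ι (Pi.single k ⟨x, hx⟩)), ⟨_, rfl⟩, ?_⟩
        rw [← hz, z.apply_symm_apply, hι, Pi.single_eq_same]
    have hVdim : Module.finrank F V = r := by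
      have h1 : Module.finrank F V = ∑ k, Module.finrank F (Y k) := by
        rw [← Module.finrank_pi_fintype]
        exact LinearMap.finrank_range_of_inj (z.symm.injective.comp hιinj)
      have h2 : ∀ k, Module.finrank F (Y k) = m - e k := fun k => by
        rw [finrank_orthogonal_traceForm, hUd]
      have h3 : ∑ k, (m - e k) + ∑ k, e k = t * m := by
        rw [← Finset.sum_add_distrib, Finset.sum_congr rfl fun k _ => Nat.sub_add_cancel (hem k)]
        simp
      have h4 : ∑ k, e k = s * m + u := by
        have := sum_fin_step (fun x => x) (m := m) (u := u) hs
        simpa [he] using this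
      rw [h1, Finset.sum_congr rfl fun k _ => h2 k]
      omega
    refine ⟨_, ⟨V.map (traceCode F n α), LinearMap.map_le_range, ?_, rfl⟩, ?_⟩
    · rw [← hVdim]
      exact (Submodule.equivMapOfInjective _ hinj V).finrank_eq.symm
    · have h1 : ∀ k : Fin t, (unitWeight (a * t) (V.map (fourierCoord F (γ ^ a) v k)) : ℝ) =
          (Nat.card L : ℝ) - 1 - B (e k) := fun k => by
        rw [hVk, hweight, orthogonal_orthogonal_traceForm, hUB]
      have h2 : ∑ k, B (e k) = s * B m + B u := by
        have := sum_fin_step B (m := m) (u := u) hs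
        simpa [he, hB0] using this
      rw [hsupp, Finset.sum_congr rfl fun k _ => h1 k, Finset.sum_sub_distrib, h2, hBm,
        Finset.sum_const, Finset.card_fin, nsmul_eq_mul]
      ring
  obtain ⟨w, hw, hwv⟩ := hupper
  -- The witness makes `S` nonempty, so the infimum is attained and is not the default value `0`.
  have hmem : genHammingWeight (LinearMap.range (traceCode F n α)) r ∈ S := Nat.sInf_mem ⟨w, hw⟩
  have hle : genHammingWeight (LinearMap.range (traceCode F n α)) r ≤ w := Nat.sInf_le hw
  apply le_antisymm
  · rw [← hwv]
    gcongr
  · exact hlower _ hmem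

/-! ### Convexity and parity for `N = 2` -/

/-- The two branches of `squareBound` agree at `u = h`. -/
theorem squareBound_of_le {q h u : ℕ} (hu : h ≤ u) :
    squareBound q h u = ((q : ℝ) ^ (u - h) + 1) * ((q : ℝ) ^ h - 1) := by
  rw [squareBound]
  split_ifs with hu'
  · obtain rfl : u = h := le_antisymm hu' hu
    rw [Nat.sub_self, pow_zero]
    norm_num
  · rfl

/-- Each branch is convex. At the kink `i + 1 = h` the claim reduces to `q ^ i * (q - 2) ≥ 1`, which
is where `q ≥ 3` enters. -/
theorem squareBound_increments {q h : ℕ} (hq : 3 ≤ q) (i : ℕ) :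
    squareBound q h (i + 1) - squareBound q h i ≤
      squareBound q h (i + 2) - squareBound q h (i + 1) := by
  have hq' : (3 : ℝ) ≤ q := by exact_mod_cast hq
  rcases lt_trichotomy (i + 1) h with hi | hi | hi
  · simp only [squareBound, if_pos hi.le, if_pos (show i ≤ h by omega),
      if_pos (show i + 2 ≤ h by omega)]
    have hp : (0 : ℝ) ≤ (q : ℝ) ^ i := by positivity
    nlinarith [mul_nonneg hp (sq_nonneg ((q : ℝ) - 1)), pow_succ (q : ℝ) i, pow_succ (q : ℝ) (i + 1)]
  · subst hi
    rw [squareBound_of_le (show i + 1 ≤ i + 2 by omega), squareBound, squareBound,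
      if_pos le_rfl, if_pos (show i ≤ i + 1 by omega), show i + 2 - (i + 1) = 1 by omega, pow_one,
      pow_succ]
    have hp : (1 : ℝ) ≤ (q : ℝ) ^ i := one_le_pow₀ (by linarith)
    nlinarith [mul_nonneg (show (0 : ℝ) ≤ (q : ℝ) - 1 by linarith)
      (show (0 : ℝ) ≤ (q : ℝ) ^ i * (q - 2) - 1 by nlinarith)]
  · obtain ⟨c, rfl⟩ : ∃ c, i = h + c := ⟨i - h, by omega⟩
    rw [squareBound_of_le (by omega), squareBound_of_le (by omega), squareBound_of_le (by omega),
      show h + c + 1 - h = c + 1 by omega, show h + c + 2 - h = c + 2 by omega,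
      Nat.add_sub_cancel_left, pow_succ, pow_succ, pow_succ]
    have hp : (1 : ℝ) ≤ (q : ℝ) ^ h := one_le_pow₀ (by linarith)
    have hc : (0 : ℝ) ≤ (q : ℝ) ^ c := by positivity
    nlinarith [mul_nonneg (mul_nonneg hc (sq_nonneg ((q : ℝ) - 1)))
      (show (0 : ℝ) ≤ (q : ℝ) ^ h - 1 by linarith)]

/-- If `q` is even then `q ^ m - 1` is odd; if `q` is odd then `k = 1 + q + ⋯ + q ^ (m - 1)` has the
parity of `m`. -/
theorem odd_and_even_of_even_quotient {q m k : ℕ} (hq : 1 < q) (hm : 0 < m)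
    (hk : k * (q - 1) = q ^ m - 1) (h2 : 2 ∣ k) : Odd q ∧ Even m := by
  rcases Nat.even_or_odd q with hqe | hqo
  · have h1 : 2 ∣ q ^ m - 1 := hk ▸ h2.mul_right _
    have h3 : 2 ∣ q ^ m := (even_iff_two_dvd.1 hqe).trans (dvd_pow_self q hm.ne')
    have h4 : 0 < q ^ m := pow_pos (by omega) m
    omega
  · refine ⟨hqo, ?_⟩
    have hk' : k = ∑ i ∈ Finset.range m, q ^ i := by
      rw [Nat.geomSum_eq hq m, ← hk, Nat.mul_div_cancel _ (by omega)]
    rw [← even_iff_two_dvd, hk', Finset.even_sum_iff_even_card_odd] at h2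
    rw [Finset.filter_true_of_mem fun i _ => hqo.pow, Finset.card_range] at h2
    exact h2

end

/-! ### The theorem -/

theorem theorem1 {F L : Type*} [Field F] [Finite F] [Field L] [Finite L] [Algebra F L]
    (q m : ℕ) (hq : Nat.card F = q) (hm : Module.finrank F L = m)
    (γ : Lˣ) (hγ : ∀ x : Lˣ, x ∈ Subgroup.zpowers γ)
    (e t : ℕ) (ht : 1 ≤ t) (het : e = t) (he : e ∣ q ^ m - 1)
    (a : ℤ) (ha : ¬ a ≡ 0 [ZMOD ((q ^ m - 1 : ℕ) : ℤ)])
    (a' Δ : Fin t → ℤ)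
    (ha' : ∀ i, a' i ≡ a + (((q ^ m - 1) / e : ℕ) : ℤ) * Δ i [ZMOD ((q ^ m - 1 : ℕ) : ℤ)])
    (hΔ : ∀ i j, i ≠ j → ¬ Δ i ≡ Δ j [ZMOD (e : ℤ)])
    (hgcd : Int.gcd (Finset.univ.gcd fun i : Fin t => Δ i - Δ ⟨0, ht⟩) (e : ℤ) = 1)
    (hdeg : ∀ i, (hPoly F γ (a' i)).natDegree = m)
    (hne : ∀ i j, i ≠ j → hPoly F γ (a' i) ≠ hPoly F γ (a' j))
    (δ n N : ℕ)
    (hδ : δ = Nat.gcd (q ^ m - 1) (Finset.univ.gcd fun i : Fin t => (a' i).natAbs))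
    (hn : n = (q ^ m - 1) / δ)
    (hN : N = Int.gcd (((q ^ m - 1) / (q - 1) : ℕ) : ℤ) (a * e))
    (C : Submodule F (Fin n → F))
    (hC : C = cyclicCode F n (∏ i : Fin t, hPoly F γ (a' i))) :
    Module.finrank F C = t * m ∧
    (N = 1 → ∀ s r : ℕ, s < t →
      ((t : ℝ) - s - 1) * m < r → (r : ℝ) ≤ ((t : ℝ) - s) * m →
      (genHammingWeight C r : ℝ) =
        ((q : ℝ) ^ m - 1) / δ * (1 - (s : ℝ) / t)
          - ((q : ℝ) ^ (((t : ℝ) - s) * m - r) - 1) / (t * δ)) ∧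
    (N = 2 → ∀ s r : ℕ, s < t →
      (((t : ℝ) - s - 1) * m < r → (r : ℝ) ≤ ((t : ℝ) - s - 1 / 2) * m →
        (genHammingWeight C r : ℝ) =
          ((q : ℝ) ^ m - 1) / δ * (1 - (s : ℝ) / t)
            - 1 / (t * δ) * ((q : ℝ) ^ (((t : ℝ) - s - 1 / 2) * m - r) + 1)
              * ((q : ℝ) ^ ((m : ℝ) / 2) - 1)) ∧
      (((t : ℝ) - s - 1 / 2) * m < r → (r : ℝ) ≤ ((t : ℝ) - s) * m →
        (genHammingWeight C r : ℝ) =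
          ((q : ℝ) ^ m - 1) / δ * (1 - (s : ℝ) / t)
            - 2 / (t * δ) * ((q : ℝ) ^ (((t : ℝ) - s) * m - r) - 1))) := by
  have := Fintype.ofFinite L
  subst het
  have hq1 : 1 < q := hq ▸ Finite.one_lt_card
  have hm0 : 0 < m := hm ▸ Module.finrank_pos
  have hcardL : Nat.card L = q ^ m := by
    rw [Module.natCard_eq_pow_finrank (K := F), hq, hm]
  have hQ1 : 0 < q ^ m - 1 := Nat.sub_pos_of_lt (Nat.one_lt_pow hm0.ne' hq1)
  have hord : orderOf γ = q ^ m - 1 := by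
    rw [orderOf_eq_card_of_forall_mem_zpowers hγ, Nat.card_units, hcardL]
  obtain ⟨M, hM⟩ := he
  have hMdiv : (q ^ m - 1) / e = M := by rw [hM, Nat.mul_div_cancel_left _ ht]
  have hδdvd : δ ∣ q ^ m - 1 := hδ ▸ Nat.gcd_dvd_left _ _
  have hδ0 : 0 < δ := Nat.pos_of_dvd_of_pos hδdvd hQ1
  have hnδ : n * δ = q ^ m - 1 := hn ▸ Nat.div_mul_cancel hδdvd
  have hn0 : 0 < n := Nat.pos_of_ne_zero (by rintro rfl; omega)
  have hδa : ∀ i, (δ : ℤ) ∣ a' i := fun i => by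
    rw [Int.natCast_dvd, hδ]
    exact (Nat.gcd_dvd_right _ _).trans (Finset.gcd_dvd (Finset.mem_univ i))
  let α : Fin e → Lˣ := fun i => γ ^ a' i
  have hα : ∀ i, α i ^ n = 1 := fun i => by
    obtain ⟨c, hc⟩ := hδa i
    change (γ ^ a' i) ^ n = 1
    rw [← zpow_natCast, ← zpow_mul, ← orderOf_dvd_iff_zpow_eq_one, hord, hc, ← hnδ]
    exact ⟨c, by push_cast; ring⟩
  have hpoly : ∀ i, hPoly F γ (a' i) = minpoly F (((α i)⁻¹ : Lˣ) : L) := fun i => by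
    rw [hPoly, zpow_neg]
  simp only [hpoly] at hdeg hne hC
  have hdeg' : ∀ i, (minpoly F (((α i)⁻¹ : Lˣ) : L)).natDegree = Module.finrank F L := fun i => by
    rw [hdeg, hm]
  have hinj := traceCode_injective (F := F) hn0 hα hdeg' hne
  have hCr : C = LinearMap.range (traceCode F n α) :=
    hC.trans (cyclicCode_eq_range_traceCode hn0 hα hdeg' hne)
  -- As the `Δ i` are distinct modulo `e`, this makes the `v i` below distinct `e`-th roots of
  -- unity.
  have hordM : orderOf (γ ^ M) = e := by
    have hM0 : M ≠ 0 := by rintro rfl; omega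
    rw [orderOf_pow_of_dvd hM0 (hord ▸ hM ▸ Dvd.intro_left _ rfl), hord, hM,
      Nat.mul_div_cancel _ (Nat.pos_of_ne_zero hM0)]
  let v : Fin e → Lˣ := fun i => (γ ^ M) ^ Δ i
  have hv : ∀ i, v i ^ e = 1 := fun i => by
    change ((γ ^ M) ^ Δ i) ^ e = 1
    rw [← zpow_natCast, ← zpow_mul, mul_comm, zpow_mul, zpow_natCast, ← hordM, pow_orderOf_eq_one,
      one_zpow]
  have hvinj : Function.Injective v := fun i j hij => by
    by_contra hne
    refine hΔ i j hne ?_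
    have := zpow_eq_zpow_iff_modEq.1 hij
    rwa [hordM] at this
  have hαv : ∀ i, α i = γ ^ a * v i := fun i => by
    change γ ^ a' i = γ ^ a * (γ ^ M) ^ Δ i
    rw [← zpow_natCast, ← zpow_mul, ← zpow_add, zpow_eq_zpow_iff_modEq, hord]
    have := ha' i
    rwa [hMdiv] at this
  obtain ⟨k, hk⟩ : q - 1 ∣ q ^ m - 1 := by simpa using Nat.sub_dvd_pow_sub_pow q 1 m
  have hkdiv : (q ^ m - 1) / (q - 1) = k := by rw [hk, Nat.mul_div_cancel_left _ (by omega)]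
  have hk' : k * (q - 1) = q ^ m - 1 := by rw [hk, mul_comm]
  rw [hkdiv] at hN
  have main := fun (B : ℕ → ℝ) h0 h1 h2 h3 h4 h5 (s r u : ℕ) hs hu hr =>
    genHammingWeight_range_traceCode (F := F) hγ (hM.symm.trans (by rw [hcardL]))
      (hnδ.trans (by rw [hcardL])) hα hαv hv hvinj hinj (by rw [hq, hcardL, hk']) hN
      (B := B) h0 h1 h2 h3 h4 h5 (s := s) (r := r) (u := u) hs hu hr
  simp only [hm, hcardL] at main
  push_cast at main
  rw [← hCr] at main
  have ht0 : (e : ℝ) ≠ 0 := by exact_mod_cast (show e ≠ 0 by omega)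
  have hδ0' : (δ : ℝ) ≠ 0 := by exact_mod_cast hδ0.ne'
  have hq1' : (1 : ℝ) < q := by exact_mod_cast hq1
  -- The range of `r` says that `u = (t - s) m - r` is a natural number below `m`.
  have hexp : ∀ s r : ℕ, s < e → ((e : ℝ) - s - 1) * m < r → (r : ℝ) ≤ ((e : ℝ) - s) * m →
      ∃ u : ℕ, u < m ∧ r + s * m + u = e * m ∧ ((e : ℝ) - s) * m - r = u := by
    intro s r hs h1 h2
    have h2' : r + s * m ≤ e * m := by
      have : (r : ℝ) + s * m ≤ e * m := by linarith
      exact_mod_cast this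
    obtain ⟨u, hu⟩ := Nat.exists_eq_add_of_le h2'
    have hu' : (e : ℝ) * m = r + s * m + u := by exact_mod_cast hu
    refine ⟨u, ?_, hu.symm, by linarith⟩
    have : (u : ℝ) < m := by linarith
    exact_mod_cast this
  have hsolve : ∀ {w x b : ℝ} {s : ℕ}, (e : ℝ) * δ * w = ((e : ℝ) - s) * x - b →
      w = x / δ * (1 - (s : ℝ) / e) - b / (e * δ) := by
    intro w x b s h
    field_simp
    linarith
  refine ⟨?_, ?_, ?_⟩
  · rw [hCr, LinearMap.finrank_range_of_inj hinj, Module.finrank_pi_fintype]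
    simp [hm]
  · rintro rfl s r hs h1 h2
    obtain ⟨u, hum, hur, hu⟩ := hexp s r hs h1 h2
    rw [hu, Real.rpow_natCast]
    have hcount : ∀ U : Submodule F L,
        (1 : ℝ) * zpowersCount (γ ^ 1) U = (q : ℝ) ^ Module.finrank F U - 1 := fun U => by
      have h := zpowersCount_generator hγ U
      rw [hq] at h
      have h' : (zpowersCount γ U : ℝ) + 1 = (q : ℝ) ^ Module.finrank F U := by exact_mod_cast h
      rw [pow_one]
      linarith
    refine hsolve (main (fun u => (q : ℝ) ^ u - 1) (by simp) (by simp [hq1'.le]) ?_ rfl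
      (fun U => by simpa using (hcount U).le) ?_ s r u hs hum hur)
    · intro i _
      have hp : (0 : ℝ) ≤ (q : ℝ) ^ i := by positivity
      simp only [pow_succ]
      nlinarith [mul_nonneg hp (sq_nonneg ((q : ℝ) - 1))]
    · intro u hu
      obtain ⟨U, -, hU⟩ := exists_submodule_le_finrank_eq (⊤ : Submodule F L) (d := u)
        (by rw [finrank_top, hm]; exact hu)
      exact ⟨U, hU, by simpa [hU] using hcount U⟩
  · rintro rfl s r hs
    have h2k : 2 ∣ k := by
      have h := Int.gcd_dvd_left (k : ℤ) (a * e)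
      rw [← hN] at h
      exact_mod_cast h
    obtain ⟨hqo, h, hmh⟩ := odd_and_even_of_even_quotient hq1 hm0 hk' h2k
    have hmh2 : m = 2 * h := by omega
    have hq3 : 3 ≤ q := by
      obtain ⟨j, hj⟩ := hqo
      omega
    have hFo : Odd (Nat.card F) := hq ▸ hqo
    have hLh : Module.finrank F L = 2 * h := by rw [hm, hmh2]
    have hcount : ∀ U : Submodule F L,
        (2 : ℝ) * zpowersCount (γ ^ 2) U = 2 * squareCount U := fun U => by
      rw [zpowersCount_sq_generator hγ]
    have hgw := fun u => main (squareBound q h) (by simp [squareBound])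
      (by
        rw [squareBound]
        split_ifs
        · simp [hq1'.le]
        · have : (1 : ℝ) ≤ (q : ℝ) ^ h := one_le_pow₀ hq1'.le
          have : (0 : ℝ) ≤ (q : ℝ) ^ (1 - h) := by positivity
          exact mul_nonneg (by linarith) (by linarith))
      (fun i _ => squareBound_increments hq3 i)
      (by
        rw [squareBound_of_le (by omega), hmh2, show 2 * h - h = h by omega, two_mul, pow_add]
        ring)
      (fun U => by
        have := two_mul_squareCount_le hFo hLh U
        rw [hq, ← hcount] at this
        exact_mod_cast this)
      (fun u hu => by
        obtain ⟨U, hUd, hU⟩ := exists_two_mul_squareCount_eq hFo hLh (u := u) (by omega)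
        rw [hq, ← hcount] at hU
        exact ⟨U, hUd, by exact_mod_cast hU⟩) s r u hs
    have hmR : (m : ℝ) = 2 * h := by exact_mod_cast hmh2
    have hm0' : (0 : ℝ) < m := by exact_mod_cast hm0
    constructor
    · intro h1 h2
      obtain ⟨u, hum, hur, hu⟩ := hexp s r hs h1 (h2.trans (mul_le_mul_of_nonneg_right (by linarith) hm0'.le))
      -- The two ranges of `r` correspond to the two branches of `squareBound`, divided at `u = h =
      -- m / 2`.
      have hhu : h ≤ u := by
        have : (h : ℝ) ≤ u := by linarith
        exact_mod_cast this
      have hw := hsolve (hgw u hum hur)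
      rw [squareBound_of_le hhu] at hw
      rw [hw, show ((e : ℝ) - s - 1 / 2) * m - r = ((u - h : ℕ) : ℝ) by
        rw [Nat.cast_sub hhu]; linarith, show (m : ℝ) / 2 = (h : ℝ) by linarith,
        Real.rpow_natCast, Real.rpow_natCast]
      ring
    · intro h1 h2
      obtain ⟨u, hum, hur, hu⟩ := hexp s r hs (lt_of_le_of_lt (mul_le_mul_of_nonneg_right (by linarith) hm0'.le) h1) h2
      have hhu : u ≤ h := by
        have : (u : ℝ) ≤ h := by linarith
        exact_mod_cast this
      have hw := hsolve (hgw u hum hur)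
      rw [squareBound, if_pos hhu] at hw
      rw [hw, hu, Real.rpow_natCast]
      ring
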